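/- Circuits consist of CNOT gates and arbitrary single-qubit gates (global phases are free), and the cost of a circuit is its number of CNOTs. A clean ancilla starts in $|0\rangle$ and is restored to $|0\rangle$; a dirty ancilla starts in an arbitrary state and is restored to it. All counts below refer to a fixed number $c\ge 0$ of clean and $a\ge 0$ of dirty ancillas being available. A diagonal gate is a diagonal unitary matrix and a permutation gate is a permutation matrix, both in the computational basis; $\operatorname{nnz}(v)$ is the number of non-zero entries of $|v\rangle$ in the computational basis; $H_v=I-2|v\rangle\langle v|$. Let - $\mathcal N_{\mathrm{SP}}(s)$ be the least number of CNOTs that suffices to implement, for every $s$-qubit state $|w\rangle$, some unitary $\mathrm{SP}_w$ with $\mathrm{SP}_w|0\rangle_s=|w\rangle$; - $\mathcal N^{\Delta}_{\mathrm{Piv}}(n,s)$ be the least number of CNOTs that suffices, for every $n$-qubit state $|w\rangle$ with $\operatorname{nnz}(w)\le 2^s$, to implement $\Delta\,\mathrm{Piv}_w$ for some diagonal gate $\Delta$ and some permutation gate $\mathrm{Piv}_w$ such that $\mathrm{Piv}_w|w\rangle=|i\rangle_{n-s}\otimes|\tilde w\rangle_s$ with $|i\rangle_{n-s}$ a computational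 basis state of the first $n-s$ qubits and $|\tilde w\rangle_s$ a state of the last $s$ qubits; - $\mathcal N_{H_0}(n)$ be the least number of CNOTs of an implementation of $H_0=I-2|0\rangle\langle 0|$ on $n$ qubits; - $\mathcal N^{\Delta\Pi}_{H}(n,s)$ be the least number of CNOTs that suffices, for every $n$-qubit state $|w\rangle$ with $\operatorname{nnz}(w)\le 2^s$, to implement $\Delta\Pi H_w$ for some diagonal gate $\Delta$ and some permutation gate $\Pi$. Let $n\ge 1$, let $|v\rangle$ be an $n$-qubit state, and let $s=\lceil\log_2\operatorname{nnz}(v)\rceil$. Then, for all $c,a\ge 0$, the reflection $H_v$ can be implemented up to diagonal and permutation gates (that is, $\Delta\Pi H_v$ can be implemented for some diagonal gate $\Delta$ and some permutation gate $\Pi$) using at most $\mathcal N^{\Delta\Pi}_{H}(n,s)$ CNOTs, and $$\mathcal N^{\Delta\Pi}_{H}(n,s)\le 2\,\mathcal N_{\mathrm{SP}}(s)+\mathcal N^{\Delta}_{\mathrm{Piv}}(n,s)+\mathcal N_{H_0}(n).$$ Explicitly, $H_v$ can be implemented up to diagonal and permutation gates - with one dirty ancilla, using at most $(n+16s-5)\operatorname{nnz}(v)+16n$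 CNOTs; - with $\max\{0,\lceil\frac{n-3}{2}\rceil\}$ clean ancillas, using at most $(n+6s-3)\operatorname{nnz}(v)+6n$ CNOTs. -/

import Mathlib

open scoped Matrix

noncomputable section

namespace QCircuit

/-- Computational basis labels of a register whose qubits are indexed by `Q`. -/
abbrev Basis (Q : Type) : Type := Q → Bool

/-- Vectors of amplitudes in the computational basis. -/
abbrev Vec (Q : Type) : Type := Basis Q → ℂ

/-- Operators on the register, as matrices in the computational basis. -/
abbrev Op (Q : Type) : Type := Matrix (Basis Q) (Basis Q) ℂ

variable {Q R : Type} [Fintype Q] [DecidableEq Q] [Fintype R] [DecidableEq R]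

/-- A (pure) state is a unit vector. -/
def IsState (v : Vec Q) : Prop := ∑ x, ‖v x‖ ^ 2 = 1

/-- The computational basis vector labelled by `x`. -/
def ket (x : Basis Q) : Vec Q := Pi.single x 1

/-- The all-zero computational basis state. -/
def ketZero : Vec Q := ket fun _ => false

/-- Tensor product of two vectors. -/
def tensor (φ : Vec Q) (ψ : Vec R) : Vec (Q ⊕ R) :=
  fun x => φ (fun q => x (Sum.inl q)) * ψ (fun r => x (Sum.inr r))

/-- The number of non-zero entries in the computational basis. -/
def nnz (v : Vec Q) : ℕ := (Function.support v).ncard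

/-! ### Circuits over CNOT and single-qubit gates -/

/-- The elementary gates: arbitrary single-qubit unitaries, CNOT gates with a control and a
target, and a global phase. On a register with at least one qubit a global phase already is a
single-qubit gate; it is listed so that registers with no qubit are covered as well. -/
inductive Gate (Q : Type) : Type
  | single (q : Q) (U : Matrix.unitaryGroup Bool ℂ) : Gate Q
  | cnot (control target : Q) (h : control ≠ target) : Gate Q
  | phase (z : ℂ) (hz : ‖z‖ = 1) : Gate Q

/-- The operator of a gate. -/
def Gate.toOp : Gate Q → Op Q
  | .single q U => Matrix.of fun x y => if ∀ r, r ≠ q → x r = y r then U.1 (x q) (y q) else 0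
  | .cnot c t _ => Matrix.of fun x y => if x = Function.update y t (xor (y t) (y c)) then 1 else 0
  | .phase z _ => z • (1 : Op Q)

/-- The number of CNOTs contributed by a gate. -/
def Gate.cnots : Gate Q → ℕ
  | .single _ _ => 0
  | .cnot _ _ _ => 1
  | .phase _ _ => 0

/-- A circuit is a list of gates; the head of the list is applied first. -/
abbrev Circuit (Q : Type) : Type := List (Gate Q)

/-- The operator of a circuit. -/
def circuitOp : Circuit Q → Op Q
  | [] => 1
  | g :: C => circuitOp C * g.toOp

/-- The CNOT count of a circuit. -/
def cnotCount (C : Circuit Q) : ℕ := (C.map Gate.cnots).sum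

/-- The circuit `C` implements the operator `U` on the register `Q` with `c` clean ancillas,
which start in the all-zero basis state and are restored to it, and `a` dirty ancillas, which
start in an arbitrary state and are restored to it. -/
def Implements {c a : ℕ} (C : Circuit (Q ⊕ (Fin c ⊕ Fin a))) (U : Op Q) : Prop :=
  ∀ (ψ : Vec Q) (φ : Vec (Fin a)),
    circuitOp C *ᵥ tensor ψ (tensor ketZero φ) = tensor (U *ᵥ ψ) (tensor ketZero φ)

/-- Some operator in `S` can be implemented with `c` clean and `a` dirty ancillas using exactly
`N` CNOTs. -/
def Achievable (c a : ℕ) (S : Set (Op Q)) (N : ℕ) : Prop :=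
  ∃ C : Circuit (Q ⊕ (Fin c ⊕ Fin a)), ∃ U ∈ S, Implements C U ∧ cnotCount C = N

/-- The least number of CNOTs with which some operator in `S` can be implemented with `c` clean
and `a` dirty ancillas (`⊤` if there is none). -/
def minCNOT (c a : ℕ) (S : Set (Op Q)) : ℕ∞ :=
  ⨅ (N : ℕ) (_ : Achievable c a S N), (N : ℕ∞)

/-! ### The gates to be implemented -/

/-- Diagonal gates. -/
def IsDiagonalGate (D : Op Q) : Prop :=
  ∃ d : Basis Q → ℂ, (∀ x, ‖d x‖ = 1) ∧ D = Matrix.diagonal d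

/-- Permutation gates. -/
def IsPermutationGate (P : Op Q) : Prop :=
  ∃ σ : Equiv.Perm (Basis Q), P = σ.permMatrix ℂ

/-- The standard Householder reflection `I - 2 |v⟩⟨v|`. -/
def householder (v : Vec Q) : Op Q := 1 - (2 : ℂ) • Matrix.vecMulVec v (star v)

/-- The unitaries that implement state preparation for `v`. -/
def statePreparations (v : Vec Q) : Set (Op Q) :=
  {U | U ∈ Matrix.unitaryGroup (Basis Q) ℂ ∧ U *ᵥ ketZero = v}

/-- `w = |i⟩ ⊗ |u⟩` for a computational basis state `|i⟩` of the first `n - s` qubits and a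
state `|u⟩` of the last `s` qubits. -/
def IsPivoted {n : ℕ} (s : ℕ) (w : Vec (Fin n)) : Prop :=
  ∃ (h : s ≤ n) (i : Basis (Fin (n - s))) (u : Vec (Fin s)), IsState u ∧
    ∀ x, w x = ket i (fun j => x ⟨j, by omega⟩) * u (fun j => x ⟨n - s + j, by omega⟩)

/-- Pivoting for `v` up to a diagonal gate: the operators `Δ Piv` with `Δ` a diagonal gate and
`Piv` a permutation gate that disentangles the first `n - s` qubits of `v` in a computational
basis state. -/
def pivotingsUpToDiagonal {n : ℕ} (s : ℕ) (v : Vec (Fin n)) : Set (Op (Fin n)) :=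
  {U | ∃ D P : Op (Fin n), IsDiagonalGate D ∧ IsPermutationGate P ∧ IsPivoted s (P *ᵥ v) ∧
    U = D * P}

/-- The operator `U` up to diagonal and permutation gates: all `Δ Π U`. -/
def upToDiagonalPermutation (U : Op Q) : Set (Op Q) :=
  {V | ∃ D P : Op Q, IsDiagonalGate D ∧ IsPermutationGate P ∧ V = D * P * U}

/-! ### CNOT counts (with `c` clean and `a` dirty ancillas) -/

/-- CNOTs required for preparing any state of `s` qubits. -/
def countSP (c a s : ℕ) : ℕ∞ :=
  ⨆ (v : Vec (Fin s)) (_ : IsState v), minCNOT c a (statePreparations v)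

/-- CNOTs required for pivoting, up to a diagonal gate, any state of `n` qubits with at most
`2 ^ s` non-zero entries. -/
def countPivDiag (c a n s : ℕ) : ℕ∞ :=
  ⨆ (v : Vec (Fin n)) (_ : IsState v ∧ nnz v ≤ 2 ^ s), minCNOT c a (pivotingsUpToDiagonal s v)

/-- CNOTs required for the standard Householder reflection of the all-zero state of `n` qubits. -/
def countH0 (c a n : ℕ) : ℕ∞ :=
  minCNOT c a {householder (ketZero : Vec (Fin n))}

/-- CNOTs required for implementing, up to diagonal and permutation gates, the standard
Householder reflection of any state of `n` qubits with at most `2 ^ s` non-zero entries. -/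
def countHouseholder (c a n s : ℕ) : ℕ∞ :=
  ⨆ (v : Vec (Fin n)) (_ : IsState v ∧ nnz v ≤ 2 ^ s),
    minCNOT c a (upToDiagonalPermutation (householder v))

end QCircuit

end

set_option linter.unusedSectionVars false

noncomputable section

namespace QCircuit

open Function

variable {Q R : Type} [Fintype Q] [DecidableEq Q] [Fintype R] [DecidableEq R]

/-! ### Circuits, their inverses and their costs -/

/-! For unitary $U$ one has $U H_v = H_{Uv} U$ (`mul_householder`). With $U=\Delta\,\mathrm{Piv}$
and a unitary $S$ satisfying $S|0\rangle = Uv$ this reads $\Delta\,\mathrm{Piv}\,H_v = S H_0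
S^\dagger\,\Delta\,\mathrm{Piv}$: one pivoting, one $H_0$ and two state preparations
(`exists_reflection_of_pivoting`). Since $\mathrm{Piv}\,v$ is a basis state tensored with an
$s$-qubit state and $\Delta$ only changes phases, $S$ is an $s$-qubit preparation followed by free
bit flips (`exists_preparation_of_isPivoted`). This is the general inequality.

For the explicit counts put $m=\operatorname{nnz}(v)$. Pivoting moves the support of $v$, label by
label, into a subcube of dimension $s$. The first label costs only bit flips; each other one costs
at most $n-1$ CNOTs and one flip with $s$ controls, of cost $T$ say (`exists_pivot_step`,
`exists_pivot`). A diagonal gate on $s$ qubits then makes all amplitudes real and non-negative, and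
multiplexed rotations prepare such a state; each of these needs $2^s-2$ CNOTs, and the preparation
occurs twice (`exists_reflection`). Finally $2^s\le 2(m-1)$ turns $3(2^s-2)$ into $6m-12$.

The controlled flips need to be correct only up to phases on basis states, because $\Delta$ absorbs
these; that is what makes them cheap. With dirty qubits, the squared product of two controlled
reflections is the identity unless both controls are on; the two halves of the control list lend
each other dirty qubits, so $T=16s-16$, and the one dirty ancilla serves $H_0$ as a target on which
this commutator is $-1$. With clean ancillas, conjunctions of three qubits are computed up to phase
with 6 CNOTs each until at most three controls remain, and are uncomputed afterwards, so that the
phases cancel; this gives $T=6s-9$ for $s\ge 2$ and $6n$ for $H_0$. -/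

theorem circuitOp_append (C C' : Circuit R) :
    circuitOp (C ++ C') = circuitOp C' * circuitOp C := by
  induction C with
  | nil => simp [circuitOp]
  | cons g C ih => simp [circuitOp, ih, Matrix.mul_assoc]

theorem cnotCount_append (C C' : Circuit R) :
    cnotCount (C ++ C') = cnotCount C + cnotCount C' := by
  simp [cnotCount]

/-- The operator acting on the target `t` by the two-by-two matrix `F x`, which may depend on the
values of the other qubits. -/
def ctrl (t : R) (F : Basis R → Matrix Bool Bool ℂ) : Op R :=
  Matrix.of fun x y => if ∀ r, r ≠ t → x r = y r then F x (x t) (y t) else 0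

/-- The function `f` does not depend on the value of the qubit `t`. -/
def IndepOf {α : Type} (t : R) (f : Basis R → α) : Prop :=
  ∀ x b, f (update x t b) = f x

theorem eq_update_of_agree {t : R} {x y : Basis R} (h : ∀ r, r ≠ t → x r = y r) :
    y = update x t (y t) := by
  funext r
  by_cases hr : r = t
  · subst hr; simp
  · simp [hr, h r hr]

theorem sum_agree {M : Type} [AddCommMonoid M] (t : R) (x : Basis R) (f : Basis R → M) :
    ∑ y, (if ∀ r, r ≠ t → x r = y r then f y else 0) = ∑ b, f (update x t b) := by
  rw [← Finset.sum_filter]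
  symm
  refine Finset.sum_bij (fun b _ => update x t b) ?_ ?_ ?_ ?_
  · intro b _
    simp only [Finset.mem_filter, Finset.mem_univ, true_and]
    intro r hr
    simp [hr]
  · intro b _ b' _ h
    have := congrFun h t
    simpa using this
  · intro y hy
    simp only [Finset.mem_filter, Finset.mem_univ, true_and] at hy
    exact ⟨y t, Finset.mem_univ _, (eq_update_of_agree hy).symm⟩
  · intros; rfl

theorem ctrl_mulVec (t : R) (F : Basis R → Matrix Bool Bool ℂ) (ψ : Vec R) (x : Basis R) :
    (ctrl t F *ᵥ ψ) x = ∑ b, F x (x t) b * ψ (update x t b) := by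
  simp only [Matrix.mulVec, dotProduct, ctrl, Matrix.of_apply, ite_mul, zero_mul]
  rw [sum_agree t x (fun y => F x (x t) (y t) * ψ y)]
  simp

/-- The product evaluates `G` at labels whose bit `t` has been changed, but `F` only at the row
label; hence independence of `t` is needed for the right factor alone. -/
theorem ctrl_mul (t : R) (F G : Basis R → Matrix Bool Bool ℂ) (hG : IndepOf t G) :
    ctrl t F * ctrl t G = ctrl t fun x => F x * G x := by
  ext x z
  rw [Matrix.mul_apply]
  simp only [ctrl, Matrix.of_apply, ite_mul, zero_mul]
  rw [sum_agree t x (fun y => F x (x t) (y t) * if ∀ r, r ≠ t → y r = z r then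
    G y (y t) (z t) else 0)]
  have h : ∀ b, (∀ r, r ≠ t → update x t b r = z r) ↔ ∀ r, r ≠ t → x r = z r := by
    intro b
    refine forall_congr' fun r => forall_congr' fun hr => ?_
    simp [hr]
  simp only [h, hG x, update_self]
  split_ifs <;> simp [Matrix.mul_apply]

theorem ctrl_one (t : R) : ctrl t (fun _ => 1) = (1 : Op R) := by
  ext x y
  simp only [ctrl, Matrix.of_apply, Matrix.one_apply]
  by_cases h : x = y
  · simp [h]
  · rw [if_neg h]
    split_ifs with h1 h2
    · exact absurd (by rw [eq_update_of_agree h1, ← h2]; simp) h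
    · rfl
    · rfl

theorem ctrl_conjTranspose (t : R) (F : Basis R → Matrix Bool Bool ℂ) (hF : IndepOf t F) :
    (ctrl t F)ᴴ = ctrl t fun x => (F x)ᴴ := by
  ext x y
  simp only [ctrl, Matrix.of_apply, Matrix.conjTranspose_apply]
  by_cases h : ∀ r, r ≠ t → x r = y r
  · have h' : ∀ r, r ≠ t → y r = x r := fun r hr => (h r hr).symm
    have : F y = F x := by
      have := hF x (y t)
      rwa [← eq_update_of_agree h] at this
    rw [if_pos h, if_pos h', this]
  · have h' : ¬ ∀ r, r ≠ t → y r = x r := fun h' => h fun r hr => (h' r hr).symm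
    rw [if_neg h, if_neg h', star_zero]

theorem IndepOf.comp₂ {α β γ : Type} {t : R} {f : Basis R → α} {g : Basis R → β}
    (hf : IndepOf t f) (hg : IndepOf t g) (k : α → β → γ) : IndepOf t fun x => k (f x) (g x) :=
  fun x b => by simp only [hf x b, hg x b]

theorem IndepOf.comp {α β : Type} {t : R} {f : Basis R → α} (hf : IndepOf t f) (k : α → β) :
    IndepOf t fun x => k (f x) :=
  fun x b => by simp only [hf x b]

theorem IndepOf.const {α : Type} (t : R) (a : α) : IndepOf t (fun _ => a) := fun _ _ => rfl

theorem IndepOf.coord {t q : R} (h : q ≠ t) : IndepOf t (fun x : Basis R => x q) :=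
  fun x b => by simp [h]

theorem IndepOf.mul {t : R} {F G : Basis R → Matrix Bool Bool ℂ} (hF : IndepOf t F)
    (hG : IndepOf t G) : IndepOf t fun x => F x * G x := hF.comp₂ hG (· * ·)

/-- The power `X ^ e` of the Pauli matrix `X`. -/
def xpow (e : Bool) : Matrix Bool Bool ℂ := Matrix.of fun a b => if a = xor b e then 1 else 0

theorem xpow_false : xpow false = 1 := by
  ext a b; simp [xpow, Matrix.one_apply]

theorem xpow_mul (a b : Bool) : xpow a * xpow b = xpow (xor a b) := by
  ext i j
  cases a <;> cases b <;> cases i <;> cases j <;> simp [xpow, Matrix.mul_apply]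

theorem xpow_conjTranspose (a : Bool) : (xpow a)ᴴ = xpow a := by
  ext i j
  cases a <;> cases i <;> cases j <;> simp [xpow]

theorem xpow_mem_unitary (a : Bool) : xpow a ∈ Matrix.unitaryGroup Bool ℂ := by
  rw [Matrix.mem_unitaryGroup_iff, Matrix.star_eq_conjTranspose, xpow_conjTranspose, xpow_mul]
  simp [xpow_false]

theorem toOp_single (q : R) (U : Matrix.unitaryGroup Bool ℂ) :
    (Gate.single q U).toOp = ctrl q fun _ => U.1 := rfl

theorem toOp_cnot (c t : R) (h : c ≠ t) :
    (Gate.cnot c t h).toOp = ctrl t fun x => xpow (x c) := by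
  ext x y
  simp only [Gate.toOp, ctrl, xpow, Matrix.of_apply]
  by_cases hxy : ∀ r, r ≠ t → x r = y r
  · rw [if_pos hxy, hxy c h]
    congr 1
    refine propext ⟨fun e => ?_, fun e => ?_⟩
    · have := congrFun e t
      simpa using this
    · funext r
      by_cases hr : r = t
      · subst hr; simp [e]
      · simp [hr, hxy r hr]
  · rw [if_neg hxy, if_neg]
    rintro rfl
    exact hxy fun r hr => by simp [hr]

/-- The inverse of a gate. -/
def Gate.inv : Gate R → Gate R
  | .single q U => .single q U⁻¹
  | .cnot c t h => .cnot c t h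
  | .phase z hz => .phase (star z) (by rw [norm_star, hz])

theorem Gate.toOp_inv (g : Gate R) : g.inv.toOp = g.toOpᴴ := by
  cases g with
  | single q U =>
    rw [Gate.inv, toOp_single, toOp_single, ctrl_conjTranspose _ _ (IndepOf.const _ _)]
    rfl
  | cnot c t h =>
    rw [Gate.inv, toOp_cnot, ctrl_conjTranspose _ _ ((IndepOf.coord h).comp xpow)]
    simp only [xpow_conjTranspose]
  | phase z hz => simp [Gate.inv, Gate.toOp, Matrix.conjTranspose_smul]

theorem Gate.conjTranspose_mul_toOp (g : Gate R) : g.toOpᴴ * g.toOp = 1 := by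
  cases g with
  | single q U =>
    rw [toOp_single, ctrl_conjTranspose _ _ (IndepOf.const _ _), ctrl_mul _ _ _ (IndepOf.const _ _)]
    have : U.1ᴴ * U.1 = 1 := (Matrix.mem_unitaryGroup_iff'.1 U.2)
    simp only [this, ctrl_one]
  | cnot c t h =>
    have hi := (IndepOf.coord h).comp xpow
    rw [toOp_cnot, ctrl_conjTranspose _ _ hi, ctrl_mul _ _ _ hi]
    simp only [xpow_conjTranspose, xpow_mul, Bool.xor_self, xpow_false, ctrl_one]
  | phase z hz =>
    have : star z * z = 1 := by
      rw [Complex.star_def, Complex.conj_mul', hz]; simp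
    rw [Gate.toOp, Matrix.conjTranspose_smul, Matrix.conjTranspose_one, smul_mul_smul_comm, this]
    simp

/-- The inverse of a circuit. -/
def Circuit.inv (C : Circuit R) : Circuit R := (C.map Gate.inv).reverse

theorem circuitOp_inv (C : Circuit R) : circuitOp (Circuit.inv C) = (circuitOp C)ᴴ := by
  induction C with
  | nil => simp [Circuit.inv, circuitOp]
  | cons g C ih =>
    have : Circuit.inv (g :: C) = Circuit.inv C ++ [g.inv] := by simp [Circuit.inv]
    rw [this, circuitOp_append, ih]
    simp [circuitOp, Gate.toOp_inv]

theorem cnotCount_inv (C : Circuit R) : cnotCount (Circuit.inv C) = cnotCount C := by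
  simp only [cnotCount, Circuit.inv, List.map_reverse, List.sum_reverse, List.map_map]
  congr 2
  funext g
  cases g <;> rfl

theorem circuitOp_conjTranspose_mul (C : Circuit R) : (circuitOp C)ᴴ * circuitOp C = 1 := by
  induction C with
  | nil => simp [circuitOp]
  | cons g C ih =>
    rw [circuitOp, Matrix.conjTranspose_mul, Matrix.mul_assoc, ← Matrix.mul_assoc (circuitOp C)ᴴ,
      ih, Matrix.one_mul, Gate.conjTranspose_mul_toOp]

/-- The operator `U` is that of a circuit with at most `k` CNOTs. -/
def CostLE (U : Op R) (k : ℕ) : Prop := ∃ C : Circuit R, circuitOp C = U ∧ cnotCount C ≤ k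

namespace CostLE

theorem one (k : ℕ) : CostLE (1 : Op R) k := ⟨[], rfl, by simp [cnotCount]⟩

theorem mono {U : Op R} {k l : ℕ} (h : CostLE U k) (hkl : k ≤ l) : CostLE U l :=
  let ⟨C, h1, h2⟩ := h
  ⟨C, h1, h2.trans hkl⟩

theorem mul {U V : Op R} {k l : ℕ} (hU : CostLE U k) (hV : CostLE V l) :
    CostLE (U * V) (k + l) := by
  obtain ⟨C, rfl, hC⟩ := hU
  obtain ⟨C', rfl, hC'⟩ := hV
  refine ⟨C' ++ C, circuitOp_append _ _, ?_⟩
  rw [cnotCount_append]; omega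

theorem conjTranspose {U : Op R} {k : ℕ} (h : CostLE U k) : CostLE Uᴴ k := by
  obtain ⟨C, rfl, hC⟩ := h
  exact ⟨Circuit.inv C, circuitOp_inv C, by rwa [cnotCount_inv]⟩

theorem conjTranspose_mul_self {U : Op R} {k : ℕ} (h : CostLE U k) : Uᴴ * U = 1 := by
  obtain ⟨C, rfl, -⟩ := h
  exact circuitOp_conjTranspose_mul C

theorem single (q : R) {U : Matrix Bool Bool ℂ} (hU : U ∈ Matrix.unitaryGroup Bool ℂ) :
    CostLE (ctrl q fun _ => U) 0 :=
  ⟨[.single q ⟨U, hU⟩], by simp [circuitOp, toOp_single], by simp [cnotCount, Gate.cnots]⟩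

theorem cnot {c t : R} (h : c ≠ t) : CostLE (ctrl t fun x => xpow (x c)) 1 :=
  ⟨[.cnot c t h], by simp [circuitOp, toOp_cnot], by simp [cnotCount, Gate.cnots]⟩

theorem phase {z : ℂ} (hz : ‖z‖ = 1) : CostLE (z • (1 : Op R)) 0 :=
  ⟨[.phase z hz], by simp [circuitOp, Gate.toOp], by simp [cnotCount, Gate.cnots]⟩

theorem ctrl_mul {t : R} {F G : Basis R → Matrix Bool Bool ℂ} {k l : ℕ}
    (hF : CostLE (ctrl t F) k) (hG : CostLE (ctrl t G) l) (hi : IndepOf t G) :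
    CostLE (ctrl t fun x => F x * G x) (k + l) := by
  rw [← QCircuit.ctrl_mul t F G hi]
  exact hF.mul hG

end CostLE

/-! ### Monomial operators -/

/-- The monomial operator sending the basis state `y` to `φ y` times the basis state `π y`. -/
def monomial (φ : Basis R → ℂ) (π : Equiv.Perm (Basis R)) : Op R :=
  Matrix.of fun x y => if x = π y then φ y else 0

theorem monomial_mul (φ φ' : Basis R → ℂ) (π π' : Equiv.Perm (Basis R)) :
    monomial φ π * monomial φ' π' = monomial (fun y => φ (π' y) * φ' y) (π * π') := by
  ext x z
  rw [Matrix.mul_apply]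
  simp only [monomial, Matrix.of_apply, Equiv.Perm.mul_apply]
  rw [Finset.sum_eq_single (π' z)]
  · simp only [if_true, ite_mul, zero_mul]
    congr
  · intro y _ hy; simp [hy]
  · simp

theorem monomial_conjTranspose (φ : Basis R → ℂ) (π : Equiv.Perm (Basis R)) :
    (monomial φ π)ᴴ = monomial (fun y => star (φ (π⁻¹ y))) π⁻¹ := by
  ext x y
  simp only [monomial, Matrix.of_apply, Matrix.conjTranspose_apply]
  by_cases h : y = π x
  · subst h; simp
  · have : x ≠ π⁻¹ y := fun h' => h (by rw [h']; simp)
    rw [if_neg h, if_neg this, star_zero]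

/-- The operator `U` permutes the basis states by `π` up to phases, and neither `π` nor the
phases involve the qubits in `T`. -/
def MonomialAway (U : Op R) (π : Equiv.Perm (Basis R)) (T : R → Prop) : Prop :=
  ∃ φ : Basis R → ℂ, (∀ x, ‖φ x‖ = 1) ∧ U = monomial φ π ∧
    ∀ t, T t → IndepOf t φ ∧ ∀ x b, π (update x t b) = update (π x) t b

namespace MonomialAway

theorem weaken {U : Op R} {π : Equiv.Perm (Basis R)} {T T' : R → Prop} (h : MonomialAway U π T)
    (hT : ∀ t, T' t → T t) : MonomialAway U π T' :=
  let ⟨φ, h1, h2, h3⟩ := h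
  ⟨φ, h1, h2, fun t ht => h3 t (hT t ht)⟩

theorem one (T : R → Prop) : MonomialAway (1 : Op R) 1 T :=
  ⟨fun _ => 1, by simp, by ext x y; simp only [monomial, Matrix.one_apply, Matrix.of_apply, Equiv.Perm.one_apply]; congr,
    fun t _ => ⟨IndepOf.const _ _, fun _ _ => rfl⟩⟩

theorem mul {U V : Op R} {π σ : Equiv.Perm (Basis R)} {T : R → Prop} (hU : MonomialAway U π T)
    (hV : MonomialAway V σ T) : MonomialAway (U * V) (π * σ) T := by
  obtain ⟨φ, h1, rfl, h3⟩ := hU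
  obtain ⟨ψ, g1, rfl, g3⟩ := hV
  refine ⟨_, fun x => ?_, monomial_mul φ ψ π σ, fun t ht => ⟨fun x b => ?_, fun x b => ?_⟩⟩
  · rw [norm_mul, h1, g1, one_mul]
  · simp only [(g3 t ht).2, (h3 t ht).1 _ b, (g3 t ht).1 _ b]
  · simp only [Equiv.Perm.mul_apply, (g3 t ht).2, (h3 t ht).2]

theorem conjTranspose {U : Op R} {π : Equiv.Perm (Basis R)} {T : R → Prop}
    (hU : MonomialAway U π T) : MonomialAway Uᴴ π⁻¹ T := by
  obtain ⟨φ, h1, rfl, h3⟩ := hU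
  have key : ∀ t, T t → ∀ x b, π⁻¹ (update x t b) = update (π⁻¹ x) t b := by
    intro t ht x b
    rw [Equiv.Perm.inv_eq_iff_eq, (h3 t ht).2]
    simp
  refine ⟨_, fun x => ?_, monomial_conjTranspose φ π, fun t ht => ⟨fun x b => ?_, key t ht⟩⟩
  · rw [norm_star, h1]
  · simp only [key t ht, (h3 t ht).1 _ b]

/-- The phases of `U` do not see the target, so they cancel between `Uᴴ` and `U`, and only the
relabelling of the controls survives. This is why compute–uncompute pairs may use flips with
arbitrary relative phases. -/
theorem conj_ctrl {U : Op R} {π : Equiv.Perm (Basis R)} {T : R → Prop}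
    (hU : MonomialAway U π T) {t : R} (ht : T t) (F : Basis R → Matrix Bool Bool ℂ) :
    Uᴴ * ctrl t F * U = ctrl t fun x => F (π x) := by
  obtain ⟨φ, h1, rfl, h3⟩ := hU
  obtain ⟨hφ, hπ⟩ := h3 t ht
  have hπt : ∀ x, π x t = x t := by
    intro x
    have := congrFun (hπ x (x t)) t
    simpa using this
  ext x z
  have e1 : ∀ y, ((monomial φ π)ᴴ * ctrl t F) x y = star (φ x) * ctrl t F (π x) y := by
    intro y
    rw [Matrix.mul_apply, Finset.sum_eq_single (π x)]
    · simp [monomial]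
    · intro w _ hw; simp [monomial, hw]
    · simp
  rw [Matrix.mul_apply, Finset.sum_eq_single (π z)]
  · rw [e1]
    simp only [monomial, ctrl, Matrix.of_apply, if_true]
    have h : (∀ r, r ≠ t → π x r = π z r) ↔ ∀ r, r ≠ t → x r = z r := by
      constructor
      · intro h
        have h2 := eq_update_of_agree h
        rw [← hπ] at h2
        have := π.injective h2
        intro r hr
        rw [this]; simp [hr]
      · intro h
        rw [eq_update_of_agree h, hπ]
        intro r hr
        simp [hr]
    simp only [h]
    split_ifs with h'
    · rw [hπt, hπt, eq_update_of_agree h', hφ]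
      have : star (φ x) * φ x = 1 := by
        rw [Complex.star_def, Complex.conj_mul', h1]; simp
      calc _ = star (φ x) * φ x * F (π x) (x t) (update x t (z t) t) := by ring
        _ = _ := by rw [this, one_mul]
    · simp
  · intro w _ hw; simp [monomial, hw]
  · simp

theorem conj_diagonal {U : Op R} {π : Equiv.Perm (Basis R)} {T : R → Prop}
    (hU : MonomialAway U π T) (d : Basis R → ℂ) :
    Uᴴ * Matrix.diagonal d * U = Matrix.diagonal fun x => d (π x) := by
  obtain ⟨φ, h1, rfl, -⟩ := hU
  ext x z
  rw [Matrix.mul_assoc, Matrix.mul_apply, Finset.sum_eq_single (π x)]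
  · simp only [monomial, Matrix.conjTranspose_apply, Matrix.of_apply, Matrix.diagonal_mul,
      if_true, Matrix.diagonal_apply]
    by_cases h : x = z
    · subst h
      simp only [if_true]
      have : star (φ x) * φ x = 1 := by
        rw [Complex.star_def, Complex.conj_mul', h1]; simp
      calc _ = star (φ x) * φ x * d (π x) := by ring
        _ = _ := by rw [this, one_mul]
    · simp [h]
  · intro w _ hw; simp [monomial, hw]
  · simp

end MonomialAway

/-- Flip the qubit `t` if `e` holds. -/
def flip (t : R) (e : Basis R → Bool) (he : IndepOf t e) : Equiv.Perm (Basis R) where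
  toFun x := update x t (xor (x t) (e x))
  invFun x := update x t (xor (x t) (e x))
  left_inv x := by simp [he x]
  right_inv x := by simp [he x]

theorem flip_apply (t : R) (e : Basis R → Bool) (he : IndepOf t e) (x : Basis R) :
    flip t e he x = update x t (xor (x t) (e x)) := rfl

/-- The matrices `F x` are monomial, and flip the bit exactly if `e x` holds. -/
def FlipsIff (F : Basis R → Matrix Bool Bool ℂ) (e : Basis R → Bool) : Prop :=
  ∀ x a b, (F x a b ≠ 0 ↔ a = xor b (e x)) ∧ (F x a b ≠ 0 → ‖F x a b‖ = 1)

theorem MonomialAway.of_ctrl {t : R} {F : Basis R → Matrix Bool Bool ℂ} {e : Basis R → Bool}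
    (hF : IndepOf t F) (he : IndepOf t e) (h : FlipsIff F e) :
    MonomialAway (ctrl t F) (flip t e he)
      fun r => r ≠ t ∧ IndepOf r F ∧ IndepOf r e := by
  refine ⟨fun y => F y (xor (y t) (e y)) (y t), fun x => ?_, ?_, fun r hr => ⟨?_, ?_⟩⟩
  · exact (h x _ _).2 ((h x _ _).1.2 rfl)
  · ext x y
    simp only [ctrl, monomial, Matrix.of_apply]
    by_cases hxy : ∀ r, r ≠ t → x r = y r
    · have hF' : F y = F x := by
        have := hF x (y t)
        rwa [← eq_update_of_agree hxy] at this
      have he' : e y = e x := by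
        have := he x (y t)
        rwa [← eq_update_of_agree hxy] at this
      rw [if_pos hxy]
      have : x = flip t e he y ↔ x t = xor (y t) (e x) := by
        rw [flip_apply, he']
        constructor
        · intro h'
          have := congrFun h' t
          simpa using this
        · intro h'
          have := eq_update_of_agree (fun r hr => (hxy r hr).symm)
          rw [h'] at this
          exact this
      simp only [this]
      split_ifs with h1
      · rw [hF', he', h1]
      · by_contra h2
        exact h1 ((h x _ _).1.1 h2)
    · rw [if_neg hxy, if_neg]
      rintro rfl
      exact hxy fun r hr => by simp [flip_apply, hr]
  · intro x b
    have : update x r b t = x t := by simp [hr.1.symm]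
    simp only [this, hr.2.1 x b, hr.2.2 x b]
  · intro x b
    have : update x r b t = x t := by simp [hr.1.symm]
    simp only [flip_apply, this, hr.2.2 x b]
    exact (update_comm hr.1 _ _ _)

/-! ### Rotations -/

/-- A one-parameter group of single-qubit gates that is inverted by conjugation with `X`. -/
structure IsRotation (g : ℝ → Matrix Bool Bool ℂ) : Prop where
  zero : g 0 = 1
  add : ∀ a b, g a * g b = g (a + b)
  conjTranspose : ∀ a, (g a)ᴴ = g (-a)
  xpow_mul : ∀ a, xpow true * g a = g (-a) * xpow true

/-- The rotation by the angle `θ` in the real plane. -/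
def rot (θ : ℝ) : Matrix Bool Bool ℂ :=
  Matrix.of fun a b => if a = b then (Real.cos θ : ℂ) else
    if a then (Real.sin θ : ℂ) else -(Real.sin θ : ℂ)

/-- The diagonal gate with the entries `exp (-iθ)` and `exp (iθ)`. -/
def rz (θ : ℝ) : Matrix Bool Bool ℂ :=
  Matrix.of fun a b => if a = b then
    (if a then Complex.exp (θ * Complex.I) else Complex.exp (-(θ * Complex.I))) else 0

theorem isRotation_rot : IsRotation rot where
  zero := by
    ext a b
    cases a <;> cases b <;> simp [rot]
  add a b := by
    ext i j
    have hc := Real.cos_add a b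
    have hs := Real.sin_add a b
    cases i <;> cases j <;> simp only [rot, Matrix.mul_apply, Fintype.sum_bool, Matrix.of_apply,
      hc, hs] <;> push_cast <;> (try simp) <;> ring
  conjTranspose a := by
    ext i j
    cases i <;> cases j <;>
      simp [rot, -Complex.ofReal_cos, -Complex.ofReal_sin]
  xpow_mul a := by
    ext i j
    cases i <;> cases j <;> simp [rot, xpow, Matrix.mul_apply]

theorem isRotation_rz : IsRotation rz where
  zero := by
    ext a b
    cases a <;> cases b <;> simp [rz]
  add a b := by
    ext i j
    cases i <;> cases j <;> simp [rz, Matrix.mul_apply, ← Complex.exp_add] <;> ring_nf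
  conjTranspose a := by
    ext i j
    cases i <;> cases j <;> simp [rz, ← Complex.exp_conj]
  xpow_mul a := by
    ext i j
    cases i <;> cases j <;> simp [rz, xpow, Matrix.mul_apply]

/-- The angle `θ`, negated if `e` holds. -/
def signed (e : Bool) (θ : ℝ) : ℝ := if e then -θ else θ

namespace IsRotation

variable {g : ℝ → Matrix Bool Bool ℂ} (hg : IsRotation g)
include hg

theorem mem_unitary (a : ℝ) : g a ∈ Matrix.unitaryGroup Bool ℂ := by
  rw [Matrix.mem_unitaryGroup_iff, Matrix.star_eq_conjTranspose, hg.conjTranspose, hg.add]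
  simp [hg.zero]

theorem xpow_mul_signed (e : Bool) (a : ℝ) : xpow e * g a = g (signed e a) * xpow e := by
  cases e
  · simp [xpow_false, signed]
  · simpa [signed] using hg.xpow_mul a

end IsRotation

/-- The controlled gate whose conjugation turns `X` into a diagonal gate if the control is off,
and fixes `X` if it is on. -/
def toggle (c : Bool) : Matrix Bool Bool ℂ := rot (Real.pi / 8) * xpow c * rot (Real.pi / 8)

theorem toggle_true_eq : toggle true = xpow true := by
  rw [toggle, Matrix.mul_assoc, isRotation_rot.xpow_mul, ← Matrix.mul_assoc, isRotation_rot.add]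
  simp [isRotation_rot.zero]

theorem toggle_false_eq : toggle false = rot (Real.pi / 4) := by
  rw [toggle, xpow_false, Matrix.mul_one, isRotation_rot.add]
  congr 1; ring

theorem rot_pi_div_two_mul_xpow :
    rot (Real.pi / 2) * xpow true = Matrix.of fun a b => if a = b then (if a then 1 else -1) else 0 := by
  ext a b
  cases a <;> cases b <;> simp [rot, xpow, Matrix.mul_apply, -Complex.ofReal_cos, -Complex.ofReal_sin]

/-- The effect of conjugating `X` by `toggle c`. -/
theorem toggle_conj_xpow (c : Bool) :
    toggle c * xpow true * (toggle c)ᴴ = if c then xpow true else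
      Matrix.of fun a b => if a = b then (if a then 1 else -1) else 0 := by
  cases c
  · rw [toggle_false_eq, isRotation_rot.conjTranspose, Matrix.mul_assoc, isRotation_rot.xpow_mul,
      ← Matrix.mul_assoc, isRotation_rot.add, ← rot_pi_div_two_mul_xpow]
    simp only [neg_neg, Bool.false_eq_true, if_false]
    congr 2; ring
  · rw [toggle_true_eq, xpow_conjTranspose, xpow_mul, xpow_mul]; simp

theorem toggle_mul_conjTranspose (c : Bool) : toggle c * (toggle c)ᴴ = 1 := by
  cases c
  · rw [toggle_false_eq, isRotation_rot.conjTranspose, isRotation_rot.add]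
    simp [isRotation_rot.zero]
  · rw [toggle_true_eq, xpow_conjTranspose, xpow_mul]; simp [xpow_false]

/-- The commutator of two controlled reflections. -/
def comm (α : ℝ) (e₁ e₂ : Bool) : Matrix Bool Bool ℂ :=
  rot α * xpow e₁ * rot (-α) * xpow e₂ * (rot α * xpow e₁ * rot (-α) * xpow e₂)

/-- With one control on, a reflection is squared. With both on, the two reflections multiply to the
rotation by `2 * α`, which is then squared. -/
theorem comm_eq (α : ℝ) (e₁ e₂ : Bool) :
    comm α e₁ e₂ = if e₁ && e₂ then rot (4 * α) else 1 := by
  have h := isRotation_rot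
  have key : ∀ e, rot α * xpow e * rot (-α) = rot (α + signed e (-α)) * xpow e := by
    intro e
    rw [Matrix.mul_assoc, h.xpow_mul_signed, ← Matrix.mul_assoc, h.add]
  rw [comm, key]
  cases e₁ <;> cases e₂ <;>
    simp [signed, xpow_false, h.zero, Matrix.mul_assoc, h.add, xpow_mul] <;>
    try simp only [← Matrix.mul_assoc]
  · rw [Matrix.mul_assoc _ (xpow true), h.xpow_mul]
    simp only [← Matrix.mul_assoc, h.add]
    rw [Matrix.mul_assoc, xpow_mul]
    simp [xpow_false, h.zero]
  · congr 1; ring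

namespace CostLE

theorem toggle {c t : R} (h : c ≠ t) : CostLE (ctrl t fun x => toggle (x c)) 1 := by
  have hr := CostLE.single t (isRotation_rot.mem_unitary (Real.pi / 8))
  exact (hr.ctrl_mul (CostLE.cnot h) ((IndepOf.coord h).comp xpow)).ctrl_mul hr (IndepOf.const _ _)
    |>.mono (by norm_num)

theorem conj_ctrl {t : R} {A F : Basis R → Matrix Bool Bool ℂ} {k l : ℕ}
    (hA : CostLE (ctrl t A) k) (hF : CostLE (ctrl t F) l) (hiA : IndepOf t A) (hiF : IndepOf t F) :
    CostLE (ctrl t fun x => A x * F x * (A x)ᴴ) (2 * k + l) := by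
  have h := hA.conjTranspose
  rw [ctrl_conjTranspose _ _ hiA] at h
  exact ((hA.ctrl_mul hF hiF).ctrl_mul h (hiA.comp _)).mono (by omega)

theorem comm {t : R} {e₁ e₂ : Basis R → Bool} {k l : ℕ} (α : ℝ)
    (h₁ : CostLE (ctrl t fun x => xpow (e₁ x)) k) (h₂ : CostLE (ctrl t fun x => xpow (e₂ x)) l)
    (hi₁ : IndepOf t e₁) (hi₂ : IndepOf t e₂) :
    CostLE (ctrl t fun x => comm α (e₁ x) (e₂ x)) (2 * k + 2 * l) := by
  have hr := CostLE.single t (isRotation_rot.mem_unitary α)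
  have hr' := CostLE.single t (isRotation_rot.mem_unitary (-α))
  have h := ((hr.ctrl_mul h₁ (hi₁.comp _)).ctrl_mul hr' (IndepOf.const _ _)).ctrl_mul h₂
    (hi₂.comp _)
  refine (h.ctrl_mul h ?_).mono (by omega)
  exact (((IndepOf.const _ _).mul (hi₁.comp _)).mul (IndepOf.const _ _)).mul (hi₂.comp _)

end CostLE

theorem FlipsIff.xpow {e : Basis R → Bool} : FlipsIff (fun x => xpow (e x)) e := by
  intro x a b
  by_cases h : a = xor b (e x) <;> simp [QCircuit.xpow, h]

/-- A Toffoli gate up to phases: if `e` is off the toggles cancel; if `e` is on, `X` survives when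
`c` is on and becomes diagonal when it is off. -/
theorem FlipsIff.toggle {c e : Basis R → Bool} :
    FlipsIff (fun x => toggle (c x) * QCircuit.xpow (e x) * (QCircuit.toggle (c x))ᴴ)
      fun x => e x && c x := by
  intro x a b
  beta_reduce
  cases e x
  · simp only [xpow_false, Matrix.mul_one, toggle_mul_conjTranspose]
    by_cases h : a = b <;> simp [h, Matrix.one_apply]
  · simp only [toggle_conj_xpow]
    cases c x <;> cases a <;> cases b <;> simp [QCircuit.xpow]

/-- At `α = π / 8` the commutator is a quarter turn, which exchanges the two basis states up to
sign. -/
theorem FlipsIff.comm {e₁ e₂ : Basis R → Bool} :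
    FlipsIff (fun x => comm (Real.pi / 8) (e₁ x) (e₂ x)) fun x => e₁ x && e₂ x := by
  intro x a b
  have h : 4 * (Real.pi / 8) = Real.pi / 2 := by ring
  simp only [comm_eq, h]
  cases (e₁ x && e₂ x) <;> cases a <;> cases b <;>
    simp [rot, -Complex.ofReal_cos, -Complex.ofReal_sin]

/-- The quarter turn commutes with all rotations, hence with `toggle false`, so a toggle could not
switch it off. Turned into a multiple of `X`, it can be toggled. -/
theorem rz_conj_rot : rz (Real.pi / 4) * rot (Real.pi / 2) * (rz (Real.pi / 4))ᴴ =
    Complex.I • xpow true := by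
  have h : Complex.exp (Real.pi / 4 * Complex.I) * Complex.exp (Real.pi / 4 * Complex.I) =
      Complex.I := by
    rw [← Complex.exp_add]
    convert Complex.exp_pi_div_two_mul_I using 2; ring
  have h' : Complex.exp (-(Real.pi / 4 * Complex.I)) * Complex.exp (-(Real.pi / 4 * Complex.I)) =
      -Complex.I := by
    rw [← Complex.exp_add]
    convert Complex.exp_neg_pi_div_two_mul_I using 2; ring
  rw [isRotation_rz.conjTranspose]
  ext a b
  cases a <;> cases b <;> simp [rz, rot, xpow, Matrix.mul_apply, -Complex.ofReal_cos, -Complex.ofReal_sin]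
  · rw [h']; simp
  · exact h

/-- The relative-phase gate with three controls. -/
theorem FlipsIff.toggle_comm {c e₁ e₂ : Basis R → Bool} :
    FlipsIff (fun x => QCircuit.toggle (c x) *
      (rz (Real.pi / 4) * QCircuit.comm (Real.pi / 8) (e₁ x) (e₂ x) * (rz (Real.pi / 4))ᴴ) *
        (QCircuit.toggle (c x))ᴴ) fun x => e₁ x && e₂ x && c x := by
  intro x a b
  have h : 4 * (Real.pi / 8) = Real.pi / 2 := by ring
  simp only [comm_eq, h]
  cases (e₁ x && e₂ x)
  · simp only [Bool.false_eq_true, if_false, Matrix.mul_one, Bool.false_and, Bool.xor_false]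
    rw [isRotation_rz.conjTranspose, isRotation_rz.add, add_neg_cancel, isRotation_rz.zero,
      Matrix.mul_one, toggle_mul_conjTranspose]
    by_cases h : a = b <;> simp [h, Matrix.one_apply]
  · simp only [if_true, rz_conj_rot, Matrix.mul_smul, Matrix.smul_mul, toggle_conj_xpow]
    cases c x <;> cases a <;> cases b <;> simp [QCircuit.xpow]

/-! ### Multi-controlled gates with dirty ancillas -/

theorem indepOf_all {t : R} {L : List R} (h : t ∉ L) : IndepOf t fun x : Basis R => L.all x := by
  intro x b
  rw [Bool.eq_iff_iff]
  simp only [List.all_eq_true]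
  refine forall_congr' fun q => forall_congr' fun hq => ?_
  have : q ≠ t := fun h' => h (h' ▸ hq)
  simp [this]

theorem all_congr {L : List R} {x y : Basis R} (h : ∀ q ∈ L, x q = y q) : L.all x = L.all y := by
  rw [Bool.eq_iff_iff]
  simp only [List.all_eq_true]
  exact forall_congr' fun q => forall_congr' fun hq => by rw [h q hq]

/-- A circuit that flips `d` if all controls are on. It may disturb the qubits in `ds`. -/
theorem exists_half_ladder (cs : List R) : ∀ (ds : List R) (d : R), cs ≠ [] →
    cs.length ≤ ds.length + 2 → (d :: (cs ++ ds)).Nodup →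
    ∃ (U : Op R) (π : Equiv.Perm (Basis R)), CostLE U (4 * cs.length - 3) ∧
      MonomialAway U π (fun t => t ∉ d :: (cs ++ ds)) ∧
      (∀ x q, q ≠ d → q ∉ ds → π x q = x q) ∧ ∀ x, π x d = xor (x d) (cs.all x) := by
  induction cs with
  | nil => intro ds d h; exact absurd rfl h
  | cons c cs ih =>
    intro ds d _ hlen hnd
    have hcd : c ≠ d := by
      rintro rfl; simp at hnd
    rcases cs with - | ⟨c₂, cs⟩
    · have he : IndepOf d fun x : Basis R => x c := IndepOf.coord hcd
      refine ⟨_, _, CostLE.cnot hcd, (MonomialAway.of_ctrl (he.comp _) he FlipsIff.xpow).weaken ?_,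
        fun x q hq _ => ?_, fun x => ?_⟩
      · intro t ht
        simp only [List.mem_cons, List.mem_append, not_or] at ht
        have : IndepOf t fun x : Basis R => x c := IndepOf.coord (fun h => ht.2.1.1 h.symm)
        exact ⟨ht.1, this.comp _, this⟩
      · simp [flip_apply, hq]
      · simp [flip_apply]
    have hT : ∀ t, IndepOf t (fun x : Basis R => x c) →
      IndepOf t (fun x : Basis R => (c₂ :: cs).all x) →
      IndepOf t (fun x : Basis R => toggle (x c) * xpow ((c₂ :: cs).all x) * (toggle (x c))ᴴ) ∧
      IndepOf t (fun x : Basis R => (c₂ :: cs).all x && x c) := by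
      intro t h1 h2
      exact ⟨((h1.comp toggle).mul (h2.comp xpow)).mul
        (h1.comp fun b => (toggle b)ᴴ), h2.comp₂ h1 _⟩
    have hd₂ : d ∉ c₂ :: cs := by
      intro h
      simp only [List.nodup_cons, List.mem_append] at hnd
      exact hnd.1 (Or.inl (List.mem_cons_of_mem _ h))
    obtain ⟨hF, he⟩ := hT d (IndepOf.coord hcd) (indepOf_all hd₂)
    have hflip := MonomialAway.of_ctrl hF he (FlipsIff.toggle)
    have hflip' := hflip.weaken (T' := fun t => t ≠ d ∧ t ≠ c ∧ t ∉ c₂ :: cs)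
      fun t ht => ⟨ht.1, hT t (IndepOf.coord ht.2.1.symm) (indepOf_all ht.2.2)⟩
    rcases cs with - | ⟨c₃, cs⟩
    · have hc₂ : c₂ ≠ d := fun h => hd₂ (by simp [h])
      refine ⟨_, _, ?_, hflip'.weaken ?_, fun x q hq _ => ?_, fun x => ?_⟩
      · have := (CostLE.toggle hcd).conj_ctrl (CostLE.cnot hc₂) ((IndepOf.coord hcd).comp _)
          ((IndepOf.coord hc₂).comp _)
        simpa using this.mono (by simp)
      · intro t ht
        simp only [List.mem_cons, List.mem_append, not_or] at ht ⊢
        tauto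
      · simp [flip_apply, hq]
      · simp [flip_apply, Bool.and_comm]
    rcases ds with - | ⟨d', ds⟩
    · simp at hlen
    -- From three controls on, the first dirty qubit `d'` is the target of a shorter ladder for the
    -- remaining controls, which may use the other dirty qubits.
    obtain ⟨V, π', hV, hVm, hVq, hVd⟩ := ih ds d' (by simp) (by simp at hlen ⊢; omega) (by
      have h1 : (c :: (c₂ :: c₃ :: cs ++ d' :: ds)).Nodup := hnd.of_cons
      have h2 := h1.of_cons
      have h3 := List.perm_middle (a := d') (l₁ := c₂ :: c₃ :: cs) (l₂ := ds)
      exact h3.nodup_iff.1 h2)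
    set cs' := c₂ :: c₃ :: cs with hcs'
    have hnd' := hnd
    simp only [List.cons_append, List.nodup_cons, List.mem_cons, List.mem_append, not_or] at hnd'
    obtain ⟨⟨-, hdcs, hdd', hdds⟩, ⟨hccs, hcd', hcds⟩, hrest⟩ := hnd'
    rw [List.nodup_append] at hrest
    obtain ⟨-, hds, hdisj⟩ := hrest
    simp only [List.nodup_cons] at hds
    have hinv : ∀ x q, q ≠ d' → q ∉ ds → π'⁻¹ x q = x q := by
      intro x q h1 h2
      have := hVq (π'⁻¹ x) q h1 h2
      simpa using this.symm
    have hcs_fix : ∀ q ∈ cs', q ≠ d' ∧ q ∉ ds := fun q hq =>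
      ⟨fun h => hdisj q hq d' (by simp) h, fun h => hdisj q hq q (by simp [h]) rfl⟩
    have hVV : Vᴴ * V = 1 := hV.conjTranspose_mul_self
    have hVV' : V * Vᴴ = 1 := by
      rw [mul_eq_one_comm]; exact hVV
    have hd'd : d' ≠ d := fun h => hdd' h.symm
    have hdT : d ∉ d' :: (cs' ++ ds) := by
      simp only [List.mem_cons, List.mem_append, not_or]
      exact ⟨hdd', hdcs, hdds⟩
    let A : Op R := ctrl d fun x => toggle (x c)
    let B : Op R := ctrl d fun x => xpow (x d')
    have hiA : IndepOf d fun x : Basis R => toggle (x c) := (IndepOf.coord hcd).comp _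
    have hiA' : IndepOf d fun x : Basis R => (toggle (x c))ᴴ := hiA.comp _
    have hiB : IndepOf d fun x : Basis R => xpow (x d') := (IndepOf.coord hd'd).comp _
    -- Moving the second `B * Aᴴ` through `Vᴴ` replaces `x d'` by `x d'` xor the conjunction of
    -- `cs'`. The unknown `x d'` cancels against the first `B`, and a toggled flip remains. The
    -- left-over `Vᴴ` is the disturbance of the dirty qubits.
    have key : A * B * Vᴴ * (B * Aᴴ) =
        ctrl d (fun x => toggle (x c) * xpow (cs'.all x) * (toggle (x c))ᴴ) * Vᴴ := by
      have e1 : B * Aᴴ = ctrl d fun x => xpow (x d') * (toggle (x c))ᴴ := by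
        rw [ctrl_conjTranspose _ _ hiA, ctrl_mul _ _ _ hiA']
      have e2 := hVm.conj_ctrl hdT fun x => xpow (x d') * (toggle (x c))ᴴ
      have hc : ∀ x, π' x c = x c := fun x => hVq x c hcd' hcds
      simp only [hc, hVd] at e2
      have e3 : Vᴴ * (B * Aᴴ) =
          ctrl d (fun x => xpow (xor (x d') (cs'.all x)) * (toggle (x c))ᴴ) * Vᴴ := by
        rw [← e2, ← e1, Matrix.mul_assoc, Matrix.mul_assoc, hVV', Matrix.mul_one]
      rw [Matrix.mul_assoc, e3, ← Matrix.mul_assoc, ctrl_mul _ _ _ hiB, ctrl_mul]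
      · congr 1
        congr 1
        funext x
        simp only [Matrix.mul_assoc]
        rw [← Matrix.mul_assoc (xpow _) (xpow _), xpow_mul]
        simp
      · exact ((((IndepOf.coord hd'd).comp₂ (indepOf_all hdcs) xor)).comp xpow).mul hiA'
    refine ⟨A * B * Vᴴ * (B * Aᴴ), flip d _ he * π'⁻¹, ?_, ?_, ?_, ?_⟩
    -- Two toggles and two CNOTs: each further control costs 4.
    · refine ((((CostLE.toggle hcd).mul (CostLE.cnot hd'd)).mul hV.conjTranspose).mul
        ((CostLE.cnot hd'd).mul (CostLE.toggle hcd).conjTranspose)).mono ?_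
      simp only [hcs', List.length_cons]
      omega
    · rw [key]
      refine (hflip'.weaken ?_).mul (hVm.conjTranspose.weaken ?_)
      all_goals
        intro t ht
        simp only [List.mem_cons, List.mem_append, not_or] at ht ⊢
        simp only [hcs', List.mem_cons, not_or] at ht ⊢
        tauto
    · intro x q hq hqds
      simp only [List.mem_cons, not_or] at hqds
      simp only [Equiv.Perm.mul_apply, flip_apply]
      rw [update_of_ne hq, hinv x q hqds.1 hqds.2]
    · intro x
      simp only [Equiv.Perm.mul_apply, flip_apply, update_self]
      rw [hinv x d hdd' hdds, hinv x c hcd' hcds,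
        all_congr (x := π'⁻¹ x) (y := x) fun q hq => hinv x q (hcs_fix q hq).1 (hcs_fix q hq).2]
      simp [Bool.and_comm]

/-- The multi-controlled `X` gate with dirty ancillas. -/
theorem CostLE.multiControlled {cs ds : List R} {t : R} (hnd : (t :: (cs ++ ds)).Nodup)
    (hlen : cs.length ≤ ds.length + 1) :
    CostLE (ctrl t fun x => xpow (cs.all x)) (8 * cs.length - 4) := by
  rcases cs with - | ⟨c, cs⟩
  · simpa using CostLE.single t (xpow_mem_unitary true)
  have hct : c ≠ t := by
    rintro rfl; simp at hnd
  rcases cs with - | ⟨c₂, cs⟩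
  · simpa using (CostLE.cnot hct).mono (l := 4) (by norm_num)
  rcases ds with - | ⟨d, ds⟩
  · simp at hlen
  set cs' := c :: c₂ :: cs with hcs'
  have hnd' : (d :: (cs' ++ ds)).Nodup := List.perm_middle.nodup_iff.1 hnd.of_cons
  have htd : t ∉ d :: (cs' ++ ds) := fun h => hnd.notMem (List.perm_middle.mem_iff.2 h)
  have hdt : d ≠ t := fun h => htd (by simp [h])
  obtain ⟨V, π, hV, hVm, -, hVd⟩ := exists_half_ladder cs' ds d (by simp [hcs'])
    (by simp at hlen ⊢; omega) hnd'
  -- Between `Vᴴ` and `V` the CNOT adds `x d` xor the conjunction to `t`; the outer CNOT removes `x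
  -- d`. Here `V` is undone completely, so dirty qubits and phases are restored, at cost `2 + 2 * (4
  -- * k - 3)` for `k` controls.
  have h1 := (CostLE.cnot hdt).mul ((hV.conjTranspose.mul (CostLE.cnot hdt)).mul hV)
  rw [hVm.conj_ctrl htd fun x => xpow (x d), QCircuit.ctrl_mul] at h1
  · simp only [hVd, xpow_mul] at h1
    have h2 : ∀ a b : Bool, xor a (xor a b) = b := by decide
    simp only [h2] at h1
    refine h1.mono ?_
    simp only [hcs', List.length_cons]
    omega
  · simp only [hVd]
    refine ((IndepOf.coord hdt).comp₂ (indepOf_all fun h => htd ?_) xor).comp xpow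
    simp [h]

/-! ### Multiplexed rotations, diagonal gates and state preparation -/

/-- The function `f` depends only on the qubits in `L`. -/
def DependsOnList {α : Type} (f : Basis R → α) (L : List R) : Prop :=
  ∀ x y, (∀ q ∈ L, x q = y q) → f x = f y

theorem DependsOnList.indepOf {α : Type} {f : Basis R → α} {L : List R} (h : DependsOnList f L)
    {t : R} (ht : t ∉ L) : IndepOf t f := by
  intro x b
  refine h _ _ fun q hq => ?_
  have : q ≠ t := fun h' => ht (h' ▸ hq)
  simp [this]

theorem DependsOnList.update {α : Type} {f : Basis R → α} {c : R} {L : List R}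
    (h : DependsOnList f (c :: L)) (b : Bool) : DependsOnList (fun x => f (update x c b)) L := by
  intro x y hxy
  refine h _ _ fun q hq => ?_
  by_cases hqc : q = c
  · subst hqc; simp
  · have := hxy q ((List.mem_cons.1 hq).resolve_left hqc)
    simp [hqc, this]

theorem DependsOnList.comp₂ {α β γ : Type} {f : Basis R → α} {g : Basis R → β} {L : List R}
    (hf : DependsOnList f L) (hg : DependsOnList g L) (k : α → β → γ) :
    DependsOnList (fun x => k (f x) (g x)) L := by
  intro x y hxy
  simp only [hf x y hxy, hg x y hxy]

theorem dependsOnList_coord {q : R} {L : List R} (h : q ∈ L) :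
    DependsOnList (fun x : Basis R => x q) L := fun _ _ hxy => hxy q h

namespace CostLE

variable {g : ℝ → Matrix Bool Bool ℂ}

/-- Conjugation by `X` negates the angle, so `g α * X ^ c * g β = g (α ± β) * X ^ c`, and the half
sum and half difference of the angles at `c = 0, 1` reproduce `θ`. Keeping the trailing `X ^ c`
saves a CNOT at every level of the recursion: `2 * (2 ^ l - 1) + 1 = 2 ^ (l + 1) - 1`. -/
theorem multiplexor_mul_xpow (hg : IsRotation g) (t : R) (L : List R) :
    ∀ (c : R) (θ : Basis R → ℝ), t ∉ c :: L → DependsOnList θ (c :: L) →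
      CostLE (ctrl t fun x => g (θ x) * xpow (x c)) (2 ^ (L.length + 1) - 1) := by
  induction L with
  | nil =>
    intro c θ ht hθ
    have hc : c ≠ t := fun h => ht (by simp [h])
    have hα := (hθ.update false).comp₂ (hθ.update true) fun a b => (a + b) / 2
    have hβ := (hθ.update false).comp₂ (hθ.update true) fun a b => (a - b) / 2
    have h := (CostLE.single t (hg.mem_unitary ((θ (Function.update (fun _ => false) c false) +
      θ (Function.update (fun _ => false) c true)) / 2))).ctrl_mul (CostLE.cnot hc)
        ((IndepOf.coord hc).comp xpow) |>.ctrl_mul (CostLE.single t (hg.mem_unitary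
      ((θ (Function.update (fun _ => false) c false) -
        θ (Function.update (fun _ => false) c true)) / 2))) (IndepOf.const _ _)
    refine (?_ : ctrl t _ = ctrl t _) ▸ h
    congr 1
    funext x
    have e1 := hα x (fun _ => false) (by simp)
    have e2 := hβ x (fun _ => false) (by simp)
    beta_reduce at e1 e2
    rw [← e1, ← e2, Matrix.mul_assoc, hg.xpow_mul_signed, ← Matrix.mul_assoc, hg.add]
    congr 2
    have hx : Function.update x c (x c) = x := by simp
    cases h : x c <;> rw [h] at hx <;> simp only [signed] <;> rw [hx] <;> simp <;> ring
  | cons c' L ih =>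
    intro c θ ht hθ
    have hc : c ≠ t := fun h => ht (by simp [h])
    have hc' : c' ≠ t := fun h => ht (by simp [h])
    have htL : t ∉ c' :: L := fun h => ht (List.mem_cons_of_mem _ h)
    have hα := (hθ.update false).comp₂ (hθ.update true) fun a b => (a + b) / 2
    have hβ := (hθ.update false).comp₂ (hθ.update true) fun a b => (a - b) / 2
    -- Both recursive factors end in `X ^ c'`. Signing the second angle by `c'` lets its `X ^ c'`
    -- pass to the left of the rotation, where it cancels the one of the first factor.
    have hβ' := (dependsOnList_coord (List.mem_cons_self (a := c') (l := L))).comp₂ hβ signed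
    have hi := ((hβ'.indepOf htL).comp g).mul ((IndepOf.coord hc').comp xpow)
    have h := ((ih c' _ htL hα).ctrl_mul (CostLE.cnot hc) ((IndepOf.coord hc).comp xpow)).ctrl_mul
      (ih c' _ htL hβ') hi
    have h' := h.mono (l := 2 ^ (L.length + 1 + 1) - 1) (by
      have : 1 ≤ 2 ^ (L.length + 1) := Nat.one_le_two_pow
      rw [pow_succ 2 (L.length + 1)]; omega)
    refine (?_ : ctrl t _ = ctrl t _) ▸ h'
    congr 1
    funext x
    rw [← hg.xpow_mul_signed]
    simp only [Matrix.mul_assoc]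
    rw [← Matrix.mul_assoc (xpow (x c)), xpow_mul, ← Matrix.mul_assoc (xpow (x c')), xpow_mul,
      Bool.xor_comm (x c), ← Bool.xor_assoc, Bool.xor_self, Bool.false_xor, hg.xpow_mul_signed,
      ← Matrix.mul_assoc, hg.add]
    congr 2
    have hx : Function.update x c (x c) = x := by simp
    cases h : x c <;> rw [h] at hx <;> simp only [signed] <;> rw [hx] <;> simp <;> ring

theorem multiplexor (hg : IsRotation g) {t : R} {L : List R} {θ : Basis R → ℝ} (ht : t ∉ L)
    (hθ : DependsOnList θ L) :
    CostLE (ctrl t fun x => g (θ x)) (if L.length = 0 then 0 else 2 ^ L.length) := by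
  rcases L with - | ⟨c, L⟩
  · have h := CostLE.single t (hg.mem_unitary (θ fun _ => false))
    refine (?_ : ctrl t _ = ctrl t _) ▸ h
    congr 1
    funext x
    rw [hθ x (fun _ => false) (by simp)]
  · have hc : c ≠ t := fun h => ht (by simp [h])
    have h := (multiplexor_mul_xpow hg t L c θ ht hθ).ctrl_mul (CostLE.cnot hc)
      ((IndepOf.coord hc).comp xpow)
    simp only [Matrix.mul_assoc, xpow_mul, Bool.xor_self, xpow_false, Matrix.mul_one] at h
    refine h.mono ?_
    have : 1 ≤ 2 ^ (L.length + 1) := Nat.one_le_two_pow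
    simp only [List.length_cons]
    rw [if_neg (by simp)]
    omega

/-- The mean of the two phases at `t = 0, 1` is a diagonal gate on fewer qubits, and half their
difference is a multiplexed `rz` on `t`. The costs add up to `(2 ^ l - 2) + 2 ^ l`; the truncated `2
^ 0 - 2` is right, a global phase being free. -/
theorem diagonal_exp (L : List R) : ∀ (θ : Basis R → ℝ), L.Nodup → DependsOnList θ L →
    CostLE (Matrix.diagonal fun x => Complex.exp (θ x * Complex.I)) (2 ^ L.length - 2) := by
  induction L with
  | nil =>
    intro θ _ hθ
    have h := CostLE.phase (R := R) (Complex.norm_exp_ofReal_mul_I (θ fun _ => false))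
    convert h.mono (Nat.zero_le _) using 1
    rw [Matrix.smul_one_eq_diagonal]
    congr 1
    funext x
    rw [hθ x (fun _ => false) (by simp)]
  | cons t L ih =>
    intro θ hnd hθ
    have ht : t ∉ L := hnd.notMem
    have hα := (hθ.update false).comp₂ (hθ.update true) fun a b => (a + b) / 2
    have hβ := (hθ.update false).comp₂ (hθ.update true) fun a b => (b - a) / 2
    have h := ((ih _ hnd.of_cons hα).mul (multiplexor isRotation_rz ht hβ)).mono
      (l := 2 ^ (L.length + 1) - 2) (by
        split_ifs with h0
        · simp [h0]
        · have : 2 ^ 1 ≤ 2 ^ L.length := Nat.pow_le_pow_right (by norm_num) (by omega)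
          rw [pow_succ]; omega)
    refine Eq.subst (motive := fun V => CostLE V _) ?_ h
    ext x y
    rw [Matrix.diagonal_mul]
    simp only [ctrl, Matrix.of_apply, rz, Matrix.diagonal_apply]
    by_cases hxy : x = y
    · subst hxy
      have hx : Function.update x t (x t) = x := by simp
      cases h : x t <;> rw [h] at hx <;> simp only [implies_true, if_true, Bool.false_eq_true,
        if_false, ← Complex.exp_add, hx] <;> congr 1 <;> push_cast <;> ring
    · rw [if_neg hxy]
      split_ifs with h1 h2
      · exact absurd (by rw [eq_update_of_agree h1, ← h2]; simp) hxy
      · exact absurd (by rw [eq_update_of_agree h1, ← h2]; simp) hxy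
      · simp
      · simp

/-- Preparation of a vector with real amplitudes, up to normalization. -/
theorem exists_prepare (L : List R) : ∀ (r : Basis R → ℝ), L.Nodup → DependsOnList r L →
    ∃ (U : Op R) (N : ℝ), CostLE U (2 ^ L.length - 2) ∧ U *ᵥ ((N : ℂ) • ketZero) =
      fun x => if ∀ q, q ∉ L → x q = false then (r x : ℂ) else 0 := by
  induction L with
  | nil =>
    intro r _ hr
    refine ⟨1, r fun _ => false, CostLE.one _, ?_⟩
    funext x
    rw [Matrix.one_mulVec, Pi.smul_apply, ketZero, ket, Pi.single_apply]
    by_cases h : x = fun _ => false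
    · simp [h]
    · rw [if_neg h, if_neg, smul_zero]
      intro h'
      exact h (funext fun q => h' q (by simp))
  | cons t L ih =>
    intro r hnd hr
    have ht : t ∉ L := hnd.notMem
    -- The amplitudes at `t = 0, 1` are read as one complex number: its norm is the amplitude to
    -- prepare on `L`, its argument the angle of the multiplexed rotation. No normalization is
    -- needed, and the zero pair causes no exception.
    have hz := (hr.update false).comp₂ (hr.update true) fun a b => (a + b * Complex.I : ℂ)
    have hφ := hz.comp₂ hz fun z _ => Complex.arg z
    have hn := hz.comp₂ hz fun z _ => ‖z‖
    beta_reduce at hφ hn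
    obtain ⟨U, N, hU, hUN⟩ := ih _ hnd.of_cons hn
    refine ⟨_, N, ((multiplexor isRotation_rot ht hφ).mul hU).mono ?_, ?_⟩
    · simp only [List.length_cons]
      split_ifs with h0
      · simp [h0]
      · have : 2 ^ 1 ≤ 2 ^ L.length := Nat.pow_le_pow_right (by norm_num) (by omega)
        rw [pow_succ]; omega
    · rw [← Matrix.mulVec_mulVec, hUN]
      funext x
      rw [ctrl_mulVec, Fintype.sum_bool]
      have e1 : ¬ ∀ q, q ∉ L → Function.update x t true q = false := fun h => by
        simpa using h t ht
      have e2 : (∀ q, q ∉ L → Function.update x t false q = false) ↔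
          ∀ q, q ∉ t :: L → x q = false := by
        refine forall_congr' fun q => ?_
        by_cases hq : q = t
        · subst hq; simp
        · simp [hq]
      rw [if_neg e1, mul_zero, zero_add]
      simp only [e2]
      split_ifs with h
      · simp only [Function.update_idem]
        set z : ℂ := (r (Function.update x t false) + r (Function.update x t true) * Complex.I : ℂ)
          with hzdef
        have h1 := Complex.norm_mul_cos_arg z
        have h2 := Complex.norm_mul_sin_arg z
        have h3 : z.re = r (Function.update x t false) := by simp [hzdef]
        have h4 : z.im = r (Function.update x t true) := by simp [hzdef]
        rw [h3] at h1
        rw [h4] at h2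
        have hx : Function.update x t (x t) = x := by simp
        cases hxt : x t <;> rw [hxt] at hx
        · simp only [rot, Matrix.of_apply, if_true]
          rw [← Complex.ofReal_mul, mul_comm, h1, hx]
        · simp only [rot, Matrix.of_apply, Bool.true_eq_false, if_false, if_true]
          rw [← Complex.ofReal_mul, mul_comm, h2, hx]
      · simp

end CostLE

/-! ### Norms and reflections -/

theorem isState_iff {v : Vec R} : IsState v ↔ star v ⬝ᵥ v = 1 := by
  have : star v ⬝ᵥ v = ((∑ x, ‖v x‖ ^ 2 : ℝ) : ℂ) := by
    simp only [dotProduct, Pi.star_apply, Complex.star_def, Complex.conj_mul']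
    push_cast; rfl
  rw [this, IsState]
  norm_cast

theorem isState_mulVec {U : Op R} (hU : Uᴴ * U = 1) {v : Vec R} : IsState (U *ᵥ v) ↔ IsState v := by
  rw [isState_iff, isState_iff, Matrix.star_mulVec, Matrix.dotProduct_mulVec, Matrix.vecMul_vecMul,
    hU, Matrix.vecMul_one]

theorem isState_ket (x : Basis R) : IsState (ket x) := by
  rw [IsState, Finset.sum_eq_single x]
  · simp [ket]
  · intro y _ hy; simp [ket, hy]
  · simp

theorem CostLE.exists_prepare_state {L : List R} {r : Basis R → ℝ} (hL : L.Nodup)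
    (hr : DependsOnList r L) {w : Vec R}
    (hw : w = fun x => if ∀ q, q ∉ L → x q = false then (r x : ℂ) else 0) (hs : IsState w) :
    ∃ U : Op R, CostLE U (2 ^ L.length - 2) ∧ U *ᵥ ketZero = w := by
  obtain ⟨U, N, hU, hUN⟩ := CostLE.exists_prepare L r hL hr
  rw [← hw] at hUN
  have h1 : IsState ((N : ℂ) • ketZero : Vec R) := by
    rw [← isState_mulVec hU.conjTranspose_mul_self, hUN]; exact hs
  have h2 : ‖(N : ℂ)‖ = 1 := by
    rw [isState_iff, star_smul, smul_dotProduct, dotProduct_smul,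
      isState_iff.1 (show IsState (ketZero : Vec R) from isState_ket _), smul_eq_mul, smul_eq_mul, mul_one, Complex.star_def,
      Complex.conj_mul'] at h1
    have h3 : ‖(N : ℂ)‖ ^ 2 = 1 := by exact_mod_cast h1
    exact (pow_eq_one_iff_of_nonneg (norm_nonneg _) two_ne_zero).1 h3
  refine ⟨U * ((N : ℂ) • 1), (hU.mul (CostLE.phase h2)).mono (by simp), ?_⟩
  rw [Matrix.mul_smul, Matrix.mul_one, Matrix.smul_mulVec, ← Matrix.mulVec_smul, hUN]

theorem householder_conj {U : Op R} (hU : Uᴴ * U = 1) (v : Vec R) :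
    U * householder v * Uᴴ = householder (U *ᵥ v) := by
  have hU' : U * Uᴴ = 1 := by rw [mul_eq_one_comm]; exact hU
  rw [householder, householder, Matrix.mul_sub, Matrix.sub_mul, Matrix.mul_one, hU', Matrix.mul_smul,
    Matrix.smul_mul, Matrix.mul_vecMulVec, Matrix.vecMulVec_mul, Matrix.star_mulVec]

/-- The identity on which all the bounds rest: a reflection is conjugated to another one by moving
its vector, so `U` can be commuted past it. -/
theorem mul_householder {U : Op R} (hU : Uᴴ * U = 1) (v : Vec R) :
    U * householder v = householder (U *ᵥ v) * U := by
  rw [← householder_conj hU, Matrix.mul_assoc, hU, Matrix.mul_one]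

theorem householder_ketZero :
    householder (ketZero : Vec R) =
      Matrix.diagonal fun x => if x = fun _ => false then -1 else 1 := by
  ext x y
  simp only [householder, ketZero, ket, Matrix.sub_apply, Matrix.smul_apply, Matrix.vecMulVec_apply,
    Matrix.one_apply, Matrix.diagonal_apply, Pi.star_apply, Pi.single_apply, smul_eq_mul]
  by_cases h : x = y
  · subst h
    by_cases h0 : x = fun _ => false <;> simp [h0]
    norm_num
  · by_cases h0 : x = fun _ => false
    · have : ¬ y = fun _ => false := fun h' => h (h0.trans h'.symm)
      simp [h, this]
    · simp [h, h0]

/-! ### Bit flips -/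

/-- The permutation that adds `b` to the basis labels. -/
def xorPerm (b : Basis R) : Equiv.Perm (Basis R) where
  toFun x q := xor (x q) (b q)
  invFun x q := xor (x q) (b q)
  left_inv x := by funext q; simp
  right_inv x := by funext q; simp

theorem xorPerm_apply (b x : Basis R) (q : R) : xorPerm b x q = xor (x q) (b q) := rfl

theorem CostLE.xorPerm (b : Basis R) : CostLE (monomial (fun _ => 1) (xorPerm b)) 0 := by
  have key : ∀ S : Finset R,
      CostLE (monomial (fun _ => 1) (QCircuit.xorPerm fun q => decide (q ∈ S))) 0 := by
    intro S
    induction S using Finset.induction_on with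
    | empty =>
      convert CostLE.one (R := R) 0
      ext x y
      simp only [monomial, Matrix.of_apply, Matrix.one_apply]
      congr 1
      refine propext (Eq.congr_right ?_)
      funext q
      simp [xorPerm_apply]
    | insert t S ht ih =>
      convert (CostLE.single t (xpow_mem_unitary true)).mul ih using 1
      ext x y
      rw [Matrix.mul_apply, Finset.sum_eq_single (QCircuit.xorPerm (fun q => decide (q ∈ S)) y)]
      · simp only [monomial, ctrl, xpow, Matrix.of_apply, if_true, mul_one, ← ite_and]
        congr 1
        refine propext ⟨?_, ?_⟩
        · rintro rfl
          refine ⟨fun r hr => ?_, ?_⟩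
          · simp [xorPerm_apply, hr]
          · simp [xorPerm_apply, ht]
        · rintro ⟨h1, h2⟩
          funext q
          by_cases hq : q = t
          · subst hq; rw [h2]; simp [xorPerm_apply, ht]
          · rw [h1 q hq]; simp [xorPerm_apply, hq]
      · intro z _ hz; simp [monomial, hz]
      · simp
  convert key (Finset.univ.filter fun q => b q = true)
  simp

theorem MonomialAway.xorPerm (b : Basis R) :
    MonomialAway (monomial (fun _ => 1) (xorPerm b)) (QCircuit.xorPerm b) fun _ => False :=
  ⟨_, by simp, rfl, fun _ h => h.elim⟩

/-! ### Flips with few controls, and compression of controls into clean ancillas -/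

/-- The costs 0, 1, 3, 6 for zero to three controls come from `X`, a CNOT, a toggled CNOT, and a
toggled commutator of two CNOTs turned to the `X` axis. -/
theorem exists_small_flip {L : List R} {t : R} (ht : t ∉ L) (hL : L.length ≤ 3) :
    ∃ F : Basis R → Matrix Bool Bool ℂ, CostLE (ctrl t F) (L.length * (L.length + 1) / 2) ∧
      FlipsIff F (fun x => L.all x) ∧ ∀ r, r ∉ L → IndepOf r F := by
  rcases L with - | ⟨c₁, - | ⟨c₂, - | ⟨c₃, - | ⟨c₄, L⟩⟩⟩⟩
  · exact ⟨fun _ => xpow true, (CostLE.single t (xpow_mem_unitary true)).mono (by simp), FlipsIff.xpow,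
      fun r _ => IndepOf.const _ _⟩
  · have h1 : c₁ ≠ t := fun h => ht (by simp [h])
    refine ⟨_, (CostLE.cnot h1).mono (by simp), ?_, fun r hr =>
      (IndepOf.coord (q := c₁) fun h => hr (by simp [h])).comp _⟩
    simpa using FlipsIff.xpow (e := fun x : Basis R => x c₁)
  · have h1 : c₁ ≠ t := fun h => ht (by simp [h])
    have h2 : c₂ ≠ t := fun h => ht (by simp [h])
    refine ⟨_, ((CostLE.toggle h2).conj_ctrl (CostLE.cnot h1) ((IndepOf.coord h2).comp _)
      ((IndepOf.coord h1).comp _)).mono (by simp), ?_, fun r hr => ?_⟩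
    · simpa using FlipsIff.toggle (c := fun x : Basis R => x c₂) (e := fun x : Basis R => x c₁)
    · have g1 : c₁ ≠ r := fun h => hr (by simp [h])
      have g2 : c₂ ≠ r := fun h => hr (by simp [h])
      exact (((IndepOf.coord g2).comp toggle).mul ((IndepOf.coord g1).comp _)).mul
        ((IndepOf.coord g2).comp fun b => (toggle b)ᴴ)
  · have h1 : c₁ ≠ t := fun h => ht (by simp [h])
    have h2 : c₂ ≠ t := fun h => ht (by simp [h])
    have h3 : c₃ ≠ t := fun h => ht (by simp [h])
    have hi : ∀ r, c₁ ≠ r → c₂ ≠ r → IndepOf r fun x : Basis R =>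
        comm (Real.pi / 8) (x c₁) (x c₂) := fun r g1 g2 =>
      (IndepOf.coord g1).comp₂ (IndepOf.coord g2) _
    have hc := (CostLE.single t (isRotation_rz.mem_unitary (Real.pi / 4))).conj_ctrl
      (CostLE.comm (Real.pi / 8) (CostLE.cnot h1) (CostLE.cnot h2) (IndepOf.coord h1)
        (IndepOf.coord h2)) (IndepOf.const _ _) (hi t h1 h2)
    refine ⟨_, ((CostLE.toggle h3).conj_ctrl hc ((IndepOf.coord h3).comp _)
      (((IndepOf.const _ _).mul (hi t h1 h2)).mul (IndepOf.const _ _))).mono (by simp), ?_,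
      fun r hr => ?_⟩
    · simpa [Bool.and_assoc] using FlipsIff.toggle_comm (c := fun x : Basis R => x c₃)
        (e₁ := fun x : Basis R => x c₁) (e₂ := fun x : Basis R => x c₂)
    · have g1 : c₁ ≠ r := fun h => hr (by simp [h])
      have g2 : c₂ ≠ r := fun h => hr (by simp [h])
      have g3 : c₃ ≠ r := fun h => hr (by simp [h])
      exact (((IndepOf.coord g3).comp toggle).mul
        (((IndepOf.const _ _).mul (hi r g1 g2)).mul (IndepOf.const _ _))).mul
        ((IndepOf.coord g3).comp fun b => (toggle b)ᴴ)
  · simp at hL; omega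

/-- The conjunction of the qubits in `L` is compressed into at most three qubits, using the clean
ancillas in `A`. -/
theorem exists_compress (A : List R) : ∀ L : List R, (A ++ L).Nodup →
    L.length ≤ 2 * A.length + 3 →
    ∃ (U : Op R) (π : Equiv.Perm (Basis R)) (L' : List R) (k : ℕ),
      CostLE U k ∧ k + 3 * L'.length = 3 * L.length ∧ L'.length ≤ 3 ∧ L'.Nodup ∧
      min 2 L.length ≤ L'.length ∧ (∀ q ∈ L', q ∈ A ++ L) ∧
      MonomialAway U π (fun t => t ∉ A ++ L) ∧
      ∀ x, (∀ q ∈ A, x q = false) → L'.all (π x) = L.all x := by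
  induction A with
  | nil =>
    intro L hnd hlen
    exact ⟨1, 1, L, 0, CostLE.one _, by simp, by simpa using hlen, by simpa using hnd, by simp,
      by simp, MonomialAway.one _, fun x _ => rfl⟩
  | cons a A ih =>
    intro L hnd hlen
    by_cases hL : L.length ≤ 3
    · exact ⟨1, 1, L, 0, CostLE.one _, by simp, hL, (List.nodup_append.1 hnd).2.1, by simp,
        by simp +contextual, MonomialAway.one _, fun x _ => rfl⟩
    rcases L with - | ⟨c₁, - | ⟨c₂, - | ⟨c₃, L⟩⟩⟩
    iterate 3 simp at hL
    have hnd1 := hnd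
    simp only [List.cons_append, List.nodup_cons, List.mem_append, not_or, List.mem_cons] at hnd1
    obtain ⟨⟨haA, ha1, ha2, ha3, haL⟩, hnd2⟩ := hnd1
    have hnd3 : (A ++ a :: L).Nodup := by
      rw [List.nodup_append] at hnd2 ⊢
      obtain ⟨h1, h2, h3⟩ := hnd2
      refine ⟨h1, List.nodup_cons.2 ⟨haL, h2.of_cons.of_cons.of_cons⟩, fun x hx y hy => ?_⟩
      rcases List.mem_cons.1 hy with rfl | hy
      · rintro rfl; exact haA hx
      · exact h3 x hx y (by simp [hy])
    -- The ancilla `a` now stands for `c₁`, `c₂`, `c₃` together. Two entries disappear for 6 CNOTs,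
    -- which preserves `k + 3 * L'.length = 3 * L.length`; a list of four drops to two, never below.
    obtain ⟨U, π, L', k, hU, hk, hL3, hLn, hL2, hLs, hUm, hUa⟩ := ih (a :: L) hnd3 (by
      simp at hlen ⊢; omega)
    have haC : a ∉ [c₁, c₂, c₃] := by simp [ha1, ha2, ha3]
    obtain ⟨F, hF, hFf, hFi⟩ := exists_small_flip haC (by simp)
    refine ⟨U * ctrl a F, π * flip a _ (indepOf_all haC), L', k + 6, hU.mul (hF.mono (by simp)), ?_, hL3, hLn,
      ?_, ?_, ?_, ?_⟩
    · simp only [List.length_cons] at hk ⊢; omega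
    · simp only [List.length_cons] at hL2 hL ⊢; omega
    · intro q hq
      have := hLs q hq
      simp only [List.mem_append, List.mem_cons] at this ⊢
      tauto
    · refine (hUm.weaken ?_).mul ((MonomialAway.of_ctrl (hFi a haC) (indepOf_all haC) hFf).weaken ?_)
      · intro t ht
        simp only [List.mem_append, List.mem_cons, List.cons_append] at ht ⊢
        tauto
      · intro t ht
        simp only [List.mem_append, List.mem_cons, List.cons_append, not_or] at ht
        have : t ∉ [c₁, c₂, c₃] := by simp [ht]
        exact ⟨ht.1, hFi t this, indepOf_all this⟩
    · intro x hx
      rw [Equiv.Perm.mul_apply, hUa]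
      · have h1 : L.all (flip a _ (indepOf_all haC) x) = L.all x := by
          refine all_congr fun q hq => ?_
          have : q ≠ a := fun h => haL (h ▸ hq)
          simp [flip_apply, this]
        have h2 : x a = false := hx a (by simp)
        rw [List.all_cons, h1, flip_apply, update_self, h2]
        simp [Bool.and_assoc]
      · intro q hq
        have : q ≠ a := fun h => haA (h ▸ hq)
        rw [flip_apply, update_of_ne this]
        exact hx q (by simp [hq])

/-! ### Circuits on a part of a register -/

open Classical in
/-- The operator `U`, acting on the qubits in the image of `e`. -/
def liftOp (e : Q → R) (U : Op Q) : Op R :=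
  Matrix.of fun x y => if ∀ r, r ∉ Set.range e → x r = y r then U (x ∘ e) (y ∘ e) else 0

theorem extend_comp_self (e : Q → R) (x : Basis R) : extend e (x ∘ e) x = x := by
  funext r
  by_cases h : ∃ q, e q = r
  · obtain ⟨q, rfl⟩ := h
    simp only [extend_def]
    split_ifs with h'
    · simp [h'.choose_spec]
    · rfl
  · rw [extend_apply' _ _ _ h]

theorem extend_extend (e : Q → R) (y z : Basis Q) (x : Basis R) :
    extend e z (extend e y x) = extend e z x := by
  funext r
  by_cases h : ∃ q, e q = r
  · simp only [extend_def, dif_pos h]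
  · rw [extend_apply' _ _ _ h, extend_apply' _ _ _ h, extend_apply' _ _ _ h]

theorem liftOp_mulVec {e : Q → R} (he : Injective e) (U : Op Q) (ψ : Vec R) (x : Basis R) :
    (liftOp e U *ᵥ ψ) x = ∑ y, U (x ∘ e) y * ψ (extend e y x) := by
  classical
  simp only [Matrix.mulVec, dotProduct, liftOp, Matrix.of_apply, ite_mul, zero_mul]
  rw [← Finset.sum_filter]
  symm
  refine Finset.sum_bij (fun y _ => extend e y x) ?_ ?_ ?_ ?_
  · intro y _
    simp only [Finset.mem_filter, Finset.mem_univ, true_and]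
    intro r hr
    rw [extend_apply' _ _ _ hr]
  · intro y _ y' _ h
    have := congrArg (· ∘ e) h
    simpa [extend_comp he] using this
  · intro z hz
    simp only [Finset.mem_filter, Finset.mem_univ, true_and] at hz
    refine ⟨z ∘ e, Finset.mem_univ _, ?_⟩
    funext r
    by_cases h : ∃ q, e q = r
    · obtain ⟨q, rfl⟩ := h
      rw [he.extend_apply]; rfl
    · rw [extend_apply' _ _ _ h, hz r h]
  · intro y _
    rw [extend_comp he]

theorem op_ext {U V : Op R} (h : ∀ ψ x, (U *ᵥ ψ) x = (V *ᵥ ψ) x) : U = V := by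
  ext x y
  simpa using h (Pi.single y 1) x

theorem liftOp_mul {e : Q → R} (he : Injective e) (U V : Op Q) :
    liftOp e (U * V) = liftOp e U * liftOp e V := by
  refine op_ext fun ψ x => ?_
  rw [← Matrix.mulVec_mulVec, liftOp_mulVec he, liftOp_mulVec he]
  simp only [liftOp_mulVec he, extend_comp he, extend_extend, Matrix.mul_apply, Finset.sum_mul,
    Finset.mul_sum]
  rw [Finset.sum_comm]
  simp only [mul_assoc]

theorem liftOp_smul_one {e : Q → R} (he : Injective e) (z : ℂ) :
    liftOp e (z • (1 : Op Q)) = z • (1 : Op R) := by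
  refine op_ext fun ψ x => ?_
  rw [liftOp_mulVec he, Finset.sum_eq_single (x ∘ e)]
  · simp [extend_comp_self, Matrix.smul_mulVec]
  · intro y _ hy
    simp [hy.symm]
  · simp

theorem liftOp_ctrl {e : Q → R} (he : Injective e) (t : Q)
    (F : Basis Q → Matrix Bool Bool ℂ) :
    liftOp e (ctrl t F) = ctrl (e t) fun x => F (x ∘ e) := by
  ext x y
  simp only [liftOp, ctrl, Matrix.of_apply, ← ite_and, comp_apply]
  congr 1
  refine propext ⟨fun ⟨h1, h2⟩ r hr => ?_, fun h => ⟨fun r hr => h r ?_, fun q hq => h _ (he.ne hq)⟩⟩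
  · by_cases h : r ∈ Set.range e
    · obtain ⟨q, rfl⟩ := h
      exact h2 q fun h => hr (by rw [h])
    · exact h1 r h
  · rintro rfl
    exact hr ⟨t, rfl⟩

/-- A gate, moved along an injection of registers. -/
def Gate.map {e : Q → R} (he : Injective e) : Gate Q → Gate R
  | .single q U => .single (e q) U
  | .cnot c t h => .cnot (e c) (e t) (he.ne h)
  | .phase z hz => .phase z hz

theorem Gate.toOp_map {e : Q → R} (he : Injective e) (g : Gate Q) :
    (g.map he).toOp = liftOp e g.toOp := by
  cases g with
  | single q U => rw [Gate.map, toOp_single, toOp_single, liftOp_ctrl he]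
  | cnot c t h => rw [Gate.map, toOp_cnot, toOp_cnot, liftOp_ctrl he]; rfl
  | phase z hz => rw [Gate.map, Gate.toOp, Gate.toOp, liftOp_smul_one he]

theorem circuitOp_map {e : Q → R} (he : Injective e) (C : Circuit Q) :
    circuitOp (C.map (Gate.map he)) = liftOp e (circuitOp C) := by
  induction C with
  | nil => simpa [circuitOp] using (liftOp_smul_one he 1).symm
  | cons g C ih => rw [List.map_cons, circuitOp, circuitOp, ih, Gate.toOp_map, liftOp_mul he]

theorem cnotCount_map {e : Q → R} (he : Injective e) (C : Circuit Q) :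
    cnotCount (C.map (Gate.map he)) = cnotCount C := by
  simp only [cnotCount, List.map_map]
  congr 2
  funext g
  cases g <;> rfl

/-! ### Implementations with ancillas -/

/-- The operator `U` can be implemented with `c` clean and `a` dirty ancillas using at most `k`
CNOTs. -/
def ImplLE (c a : ℕ) (U : Op Q) (k : ℕ) : Prop :=
  ∃ C : Circuit (Q ⊕ (Fin c ⊕ Fin a)), Implements C U ∧ cnotCount C ≤ k

namespace ImplLE

variable {c a : ℕ}

theorem mono {U : Op Q} {k l : ℕ} (h : ImplLE c a U k) (hkl : k ≤ l) : ImplLE c a U l :=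
  let ⟨C, h1, h2⟩ := h
  ⟨C, h1, h2.trans hkl⟩

theorem mul {U V : Op Q} {k l : ℕ} (hU : ImplLE c a U k) (hV : ImplLE c a V l) :
    ImplLE c a (U * V) (k + l) := by
  obtain ⟨C, hC, hk⟩ := hU
  obtain ⟨C', hC', hl⟩ := hV
  refine ⟨C' ++ C, fun ψ φ => ?_, by rw [cnotCount_append]; omega⟩
  rw [circuitOp_append, ← Matrix.mulVec_mulVec, hC', hC, Matrix.mulVec_mulVec]

/-- The circuit is unitary on the whole register, so applying its inverse to the defining identity
at `Uᴴ *ᵥ ψ` suffices. -/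
theorem conjTranspose {U : Op Q} {k : ℕ} (h : ImplLE c a U k) (hU : Uᴴ * U = 1) :
    ImplLE c a Uᴴ k := by
  obtain ⟨C, hC, hk⟩ := h
  refine ⟨Circuit.inv C, fun ψ φ => ?_, by rwa [cnotCount_inv]⟩
  have hU' : U * Uᴴ = 1 := by rw [mul_eq_one_comm]; exact hU
  have := hC (Uᴴ *ᵥ ψ) φ
  rw [Matrix.mulVec_mulVec, hU', Matrix.one_mulVec] at this
  rw [circuitOp_inv, ← this, Matrix.mulVec_mulVec, circuitOp_conjTranspose_mul, Matrix.one_mulVec]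

theorem lift {e : Q → R} (he : Injective e) {U : Op Q} {k : ℕ} (h : ImplLE c a U k) :
    ImplLE c a (liftOp e U) k := by
  obtain ⟨C, hC, hk⟩ := h
  have he' : Injective (Sum.map e (id : Fin c ⊕ Fin a → _)) := he.sumMap injective_id
  refine ⟨C.map (Gate.map he'), fun ψ φ => ?_, by rwa [cnotCount_map]⟩
  rw [circuitOp_map]
  funext x
  rw [liftOp_mulVec he']
  have key : ∀ y, tensor ψ (tensor ketZero φ) (extend (Sum.map e id) y x) =
      tensor (fun z => ψ (extend e z fun q => x (Sum.inl q))) (tensor ketZero φ) y := by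
    intro y
    have e1 : (fun q => extend (Sum.map e id) y x (Sum.inl q)) =
        extend e (fun q => y (Sum.inl q)) fun q => x (Sum.inl q) := by
      funext r
      by_cases h : ∃ q, e q = r
      · obtain ⟨q, rfl⟩ := h
        rw [he.extend_apply]
        exact he'.extend_apply y x (Sum.inl q)
      · rw [extend_apply' _ _ _ h, extend_apply']
        rintro ⟨q | q, hq⟩
        · exact h ⟨q, Sum.inl_injective hq⟩
        · simp at hq
    have e2 : ∀ r, extend (Sum.map e id) y x (Sum.inr r) = y (Sum.inr r) :=
      fun r => he'.extend_apply y x (Sum.inr r)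
    simp only [tensor, e1, e2]
  simp only [key]
  have := congrFun (hC (fun z => ψ (extend e z fun q => x (Sum.inl q))) φ) (x ∘ Sum.map e id)
  rw [Matrix.mulVec, dotProduct] at this
  rw [this]
  simp only [tensor, liftOp_mulVec he]
  rfl

theorem of_costLE {U : Op Q} {k : ℕ} (h : CostLE U k) : ImplLE c a U k := by
  obtain ⟨C, rfl, hk⟩ := h
  have he : Injective (Sum.inl : Q → Q ⊕ (Fin c ⊕ Fin a)) := Sum.inl_injective
  refine ⟨C.map (Gate.map he), fun ψ φ => ?_, by rwa [cnotCount_map]⟩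
  rw [circuitOp_map]
  funext x
  rw [liftOp_mulVec he]
  have e1 : ∀ y : Basis Q, (fun q => extend (Sum.inl : Q → Q ⊕ (Fin c ⊕ Fin a)) y x (Sum.inl q)) = y :=
    fun y => extend_comp he y x
  have e2 : ∀ (y : Basis Q) (r : Fin c ⊕ Fin a), extend Sum.inl y x (Sum.inr r) = x (Sum.inr r) :=
    fun y r => extend_apply' _ _ _ (by simp)
  simp only [tensor, e1, e2, ← mul_assoc, ← Finset.sum_mul]
  rfl

/-- The input is supported on labels with all clean ancillas 0, and the operator changes only the
qubit `t`, so values of `F` at other labels are irrelevant. -/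
theorem of_ctrl {t : Q} {F : Basis (Q ⊕ (Fin c ⊕ Fin a)) → Matrix Bool Bool ℂ}
    {F' : Basis Q → Matrix Bool Bool ℂ} {k : ℕ} (h : CostLE (ctrl (Sum.inl t) F) k)
    (hF : ∀ x, (∀ i, x (Sum.inr (Sum.inl i)) = false) → F x = F' fun q => x (Sum.inl q)) :
    ImplLE c a (ctrl t F') k := by
  obtain ⟨C, hC, hk⟩ := h
  refine ⟨C, fun ψ φ => ?_, hk⟩
  funext x
  rw [hC, ctrl_mulVec]
  have e1 : ∀ b, (fun q => update x (Sum.inl t) b (Sum.inl q)) = update (fun q => x (Sum.inl q)) t b :=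
    fun b => by
      funext q
      by_cases h : q = t
      · subst h; simp
      · simp [h]
  simp only [tensor, ctrl_mulVec, e1]
  by_cases hx : ∀ i, x (Sum.inr (Sum.inl i)) = false
  · simp only [hF x hx, Finset.sum_mul]
    refine Finset.sum_congr rfl fun b _ => ?_
    simp [mul_assoc]
  · have : (fun i => x (Sum.inr (Sum.inl i))) ≠ fun _ => false := fun h => hx fun i => congrFun h i
    simp [ketZero, ket, this]

theorem of_diagonal {d : Basis (Q ⊕ (Fin c ⊕ Fin a)) → ℂ} {d' : Basis Q → ℂ} {k : ℕ}
    (h : CostLE (Matrix.diagonal d) k)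
    (hd : ∀ x, (∀ i, x (Sum.inr (Sum.inl i)) = false) → d x = d' fun q => x (Sum.inl q)) :
    ImplLE c a (Matrix.diagonal d') k := by
  obtain ⟨C, hC, hk⟩ := h
  refine ⟨C, fun ψ φ => ?_, hk⟩
  funext x
  rw [hC, Matrix.mulVec_diagonal]
  simp only [tensor, Matrix.mulVec_diagonal]
  by_cases hx : ∀ i, x (Sum.inr (Sum.inl i)) = false
  · rw [hd x hx, mul_assoc]
  · have : (fun i => x (Sum.inr (Sum.inl i))) ≠ fun _ => false := fun h => hx fun i => congrFun h i
    simp [ketZero, ket, this]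

/-- The reflection about the all-zero state is the all-controlled phase flip up to bit flips. -/
theorem householder_ketZero {k : ℕ} {L : List Q} (hL : ∀ q, q ∈ L)
    (h : ImplLE c a (Matrix.diagonal fun x : Basis Q => if L.all x then (-1 : ℂ) else 1) k) :
    ImplLE c a (householder (ketZero : Vec Q)) k := by
  have hx := CostLE.xorPerm (fun _ : Q => true)
  -- Flipping all qubits exchanges the all-zero and the all-one label.
  have h' := ((of_costLE hx.conjTranspose).mul h).mul (of_costLE hx)
  rw [(MonomialAway.xorPerm _).conj_diagonal, zero_add, add_zero] at h'
  convert h' using 1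
  rw [QCircuit.householder_ketZero]
  congr 1
  funext x
  congr 1
  simp only [List.all_eq_true, xorPerm_apply, funext_iff]
  refine propext ⟨fun h q _ => by simp [h], fun h q => by simpa using h q (hL q)⟩

end ImplLE

/-! ### Gates with one dirty ancilla -/

/-- Each half of the controls serves as dirty ancillas for the multi-controlled `X` on the other
half; the lengths differ by at most one, as `multiControlled` allows. -/
theorem CostLE.comm_all {L : List R} {t : R} (ht : t ∉ L) (hL : L.Nodup) (α : ℝ) :
    CostLE (ctrl t fun x => QCircuit.comm α ((L.take ((L.length + 1) / 2)).all x)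
      ((L.drop ((L.length + 1) / 2)).all x))
      (2 * (8 * ((L.length + 1) / 2) - 4) + 2 * (8 * (L.length / 2) - 4)) := by
  have hs := L.take_append_drop ((L.length + 1) / 2)
  have l1 : (L.take ((L.length + 1) / 2)).length = (L.length + 1) / 2 := by simp; omega
  have l2 : (L.drop ((L.length + 1) / 2)).length = L.length / 2 := by simp; omega
  set L₁ := L.take ((L.length + 1) / 2) with hL₁
  set L₂ := L.drop ((L.length + 1) / 2) with hL₂
  have hnd : (t :: (L₁ ++ L₂)).Nodup := by rw [hs]; exact List.nodup_cons.2 ⟨ht, hL⟩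
  have hnd' : (t :: (L₂ ++ L₁)).Nodup :=
    (List.Perm.cons t List.perm_append_comm).nodup_iff.1 hnd
  have h1 := CostLE.multiControlled hnd (by omega)
  have h2 := CostLE.multiControlled hnd' (by omega)
  rw [l1] at h1
  rw [l2] at h2
  rw [← hs] at ht
  simp only [List.mem_append, not_or] at ht
  exact CostLE.comm α h1 h2 (indepOf_all ht.1) (indepOf_all ht.2)

theorem all_take_and_drop (L : List R) (k : ℕ) (x : Basis R) :
    ((L.take k).all x && (L.drop k).all x) = L.all x := by
  rw [← List.all_append, List.take_append_drop]

theorem exists_flip_of_small (c a : ℕ) {L : List Q} {t : Q} (ht : t ∉ L) (hL : L.length = 1) :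
    ∃ M : Op Q, ImplLE c a M 1 ∧ MonomialAway M (flip t _ (indepOf_all ht)) fun _ => False := by
  obtain ⟨F, hF, hFf, hFi⟩ := exists_small_flip ht (by omega)
  rw [hL] at hF
  exact ⟨_, ImplLE.of_costLE hF,
    (MonomialAway.of_ctrl (hFi t ht) (indepOf_all ht) hFf).weaken fun _ h => h.elim⟩

/-- No ancilla is touched. Once both halves are non-empty, no subtraction is truncated and the cost
of `comm_all` is exactly `16 * L.length - 16`. -/
theorem exists_flip_dirty (c a : ℕ) {L : List Q} {t : Q} (ht : t ∉ L) (hL : L.Nodup)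
    (h2 : 2 ≤ L.length) :
    ∃ M : Op Q, ImplLE c a M (16 * L.length - 16) ∧
      MonomialAway M (flip t _ (indepOf_all ht)) fun _ => False := by
  have h := CostLE.comm_all ht hL (Real.pi / 8)
  refine ⟨_, (ImplLE.of_costLE h).mono (by omega), ?_⟩
  have hf := FlipsIff.comm (e₁ := fun x : Basis Q => (L.take ((L.length + 1) / 2)).all x)
    (e₂ := fun x => (L.drop ((L.length + 1) / 2)).all x)
  simp only [all_take_and_drop] at hf
  refine (MonomialAway.of_ctrl ?_ (indepOf_all ht) hf).weaken fun _ h => h.elim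
  exact (indepOf_all fun h => ht (List.mem_of_mem_take h)).comp₂
    (indepOf_all fun h => ht (List.mem_of_mem_drop h)) _

theorem rot_pi : rot Real.pi = -1 := by
  ext a b
  cases a <;> cases b <;> simp [rot]

theorem all_map_inl {A : Type} (L : List Q) (x : Basis (Q ⊕ A)) :
    (L.map Sum.inl).all x = L.all fun q => x (Sum.inl q) := by
  rw [List.all_map]; rfl

/-- With the dirty ancilla as target and `α = π / 4`, the commutator is a half turn, that is, the
scalar `-1`. It acts as a phase on the controls and leaves the ancilla alone. -/
theorem ImplLE.householder_ketZero_dirty {L : List Q} (hL : L.Nodup) (hm : ∀ q, q ∈ L) :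
    ImplLE 0 1 (householder (ketZero : Vec Q)) (16 * L.length) := by
  refine ImplLE.householder_ketZero hm ?_
  have ht : (Sum.inr (Sum.inr 0) : Q ⊕ (Fin 0 ⊕ Fin 1)) ∉ L.map Sum.inl := by simp
  have h := CostLE.comm_all ht (hL.map Sum.inl_injective) (Real.pi / 4)
  have h4 : 4 * (Real.pi / 4) = Real.pi := by ring
  simp only [comm_eq, all_take_and_drop, h4, rot_pi] at h
  have e : ctrl (Sum.inr (Sum.inr 0) : Q ⊕ (Fin 0 ⊕ Fin 1))
      (fun x => if (L.map Sum.inl).all x then (-1 : Matrix Bool Bool ℂ) else 1) =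
      Matrix.diagonal fun x => if (L.map Sum.inl).all x then -1 else 1 := by
    refine op_ext fun ψ x => ?_
    rw [ctrl_mulVec, Matrix.mulVec_diagonal, Finset.sum_eq_single (x (Sum.inr (Sum.inr 0)))]
    · split_ifs <;> simp
    · intro b _ hb
      split_ifs <;> simp [hb.symm]
    · simp
  rw [e] at h
  refine (ImplLE.of_diagonal h fun x _ => ?_).mono (by simp; omega)
  rw [all_map_inl]

/-! ### Gates with clean ancillas -/

/-- The list of the clean ancillas. -/
def cleanList (Q : Type) (c a : ℕ) : List (Q ⊕ (Fin c ⊕ Fin a)) :=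
  (List.finRange c).map fun i => Sum.inr (Sum.inl i)

theorem exists_compress_clean {L : List Q} {c : ℕ} (hL : L.Nodup) (hc : L.length ≤ 2 * c + 3) :
    ∃ (U : Op (Q ⊕ (Fin c ⊕ Fin 0))) (π : Equiv.Perm (Basis (Q ⊕ (Fin c ⊕ Fin 0))))
      (L' : List (Q ⊕ (Fin c ⊕ Fin 0))) (k : ℕ),
      CostLE U k ∧ k + 3 * L'.length = 3 * L.length ∧ L'.length ≤ 3 ∧ L'.Nodup ∧
      min 2 L.length ≤ L'.length ∧
      (∀ t, t ∉ L → Sum.inl t ∉ L') ∧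
      MonomialAway U π (fun r => ∃ t, t ∉ L ∧ Sum.inl t = r) ∧
      ∀ x, (∀ i, x (Sum.inr (Sum.inl i)) = false) → L'.all (π x) = L.all fun q => x (Sum.inl q) := by
  have hnd : (cleanList Q c 0 ++ L.map Sum.inl).Nodup := by
    refine List.nodup_append.2 ⟨?_, hL.map Sum.inl_injective, ?_⟩
    · exact (List.nodup_finRange c).map (Sum.inr_injective.comp Sum.inl_injective)
    · intro x hx y hy
      simp only [cleanList, List.mem_map] at hx hy
      obtain ⟨i, -, rfl⟩ := hx
      obtain ⟨q, -, rfl⟩ := hy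
      simp
  have hmem : ∀ t, t ∉ L → Sum.inl t ∉ cleanList Q c 0 ++ L.map Sum.inl := by
    intro t ht h
    simp [cleanList, ht] at h
  obtain ⟨U, π, L', k, h1, h2, h3, h4, h5, h6, h7, h8⟩ := exists_compress _ _ hnd (by
    simpa [cleanList] using hc)
  refine ⟨U, π, L', k, h1, by simpa using h2, h3, h4, by simpa using h5,
    fun t ht h => hmem t ht (h6 _ h), h7.weaken ?_, fun x hx => ?_⟩
  · rintro r ⟨t, ht, rfl⟩
    exact hmem t ht
  · rw [h8, all_map_inl]
    intro q hq
    simp only [cleanList, List.mem_map] at hq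
    obtain ⟨i, -, rfl⟩ := hq
    exact hx i

theorem exists_flip_clean {L : List Q} {t : Q} {c : ℕ} (ht : t ∉ L) (hL : L.Nodup)
    (h2 : 2 ≤ L.length) (hc : L.length ≤ 2 * c + 3) :
    ∃ M : Op Q, ImplLE c 0 M (6 * L.length - 9) ∧
      MonomialAway M (flip t _ (indepOf_all ht)) fun _ => False := by
  obtain ⟨U, π, L', k, hU, hk, hL3, -, hL2, hL't, hUm, hUa⟩ := exists_compress_clean hL hc
  obtain ⟨F, hF, hFf, hFi⟩ := exists_small_flip (hL't t ht) hL3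
  have hcost := (hU.conjTranspose.mul hF).mul hU
  rw [hUm.conj_ctrl ⟨t, ht, rfl⟩] at hcost
  have hx : ∀ x : Basis (Q ⊕ (Fin c ⊕ Fin 0)), (∀ i, x (Sum.inr (Sum.inl i)) = false) →
      x = Sum.elim (fun q => x (Sum.inl q)) fun _ => false := by
    intro x hx
    funext r
    rcases r with q | i | i
    · rfl
    · exact hx i
    · exact i.elim0
  have hcost' := ImplLE.of_ctrl (F' := fun y => F (π (Sum.elim y fun _ => false))) hcost
    fun x h => by rw [← hx x h]
  refine ⟨_, hcost'.mono ?_, (MonomialAway.of_ctrl ?_ (indepOf_all ht) ?_).weaken fun _ h => h.elim⟩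
  -- Two remaining controls give `2 * (3 * m - 6) + 3` for `m` controls, three give `2 * (3 * m - 9)
  -- + 6`. A single one would exceed the bound, hence the lower bound on `L'.length`.
  · have : L'.length = 2 ∨ L'.length = 3 := by omega
    rcases this with h | h <;> rw [h] at hk ⊢ <;> omega
  · obtain ⟨φ, -, -, h⟩ := hUm
    intro y b
    have e1 : Sum.elim (update y t b) (fun _ : Fin c ⊕ Fin 0 => false) =
        update (Sum.elim y fun _ => false) (Sum.inl t) b := by
      funext r
      rcases r with q | i
      · by_cases h : q = t
        · subst h; simp
        · simp [h]
      · simp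
    beta_reduce
    rw [e1, (h _ ⟨t, ht, rfl⟩).2, hFi _ (hL't t ht)]
  · intro y a b
    have h := hFf (π (Sum.elim y fun _ => false)) a b
    beta_reduce at h ⊢
    rwa [hUa _ fun _ => rfl] at h

theorem ImplLE.householder_ketZero_clean {L : List Q} {c : ℕ} (hL : L.Nodup) (hm : ∀ q, q ∈ L)
    (hc : L.length ≤ 2 * c + 3) :
    ImplLE c 0 (householder (ketZero : Vec Q)) (6 * L.length) := by
  refine ImplLE.householder_ketZero hm ?_
  obtain ⟨U, π, L', k, hU, hk, hL3, hLn, -, -, hUm, hUa⟩ := exists_compress_clean hL hc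
  have hd : DependsOnList (fun x : Basis (Q ⊕ (Fin c ⊕ Fin 0)) =>
      if L'.all x then Real.pi else 0) L' := by
    intro x y hxy
    simp only [all_congr hxy]
  have h := (hU.conjTranspose.mul (CostLE.diagonal_exp L' _ hLn hd)).mul hU
  rw [hUm.conj_diagonal] at h
  refine (ImplLE.of_diagonal h fun x hx => ?_).mono ?_
  · rw [hUa x hx]
    split_ifs <;> simp
  -- The cost is `6 * m - 6 * l + (2 ^ l - 2)` with `l = L'.length ≤ 3`.
  · have : 2 ^ L'.length ≤ 2 + 6 * L'.length := by
      have : L'.length = 0 ∨ L'.length = 1 ∨ L'.length = 2 ∨ L'.length = 3 := by omega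
      rcases this with h | h | h | h <;> rw [h] <;> norm_num
    omega

/-! ### Pivoting -/

/-- The labels `x` that vanish outside of `L`. -/
def Inside (L : List Q) (x : Basis Q) : Prop := ∀ q, q ∉ L → x q = false

theorem exists_fan_out (j : Q) (D : Finset Q) (hj : j ∉ D) :
    ∃ (M : Op Q) (σ : Equiv.Perm (Basis Q)), CostLE M D.card ∧
      MonomialAway M σ (fun _ => False) ∧ ∀ x q, σ x q = xor (x q) (x j && decide (q ∈ D)) := by
  induction D using Finset.induction_on with
  | empty => exact ⟨1, 1, CostLE.one _, MonomialAway.one _, by simp⟩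
  | insert t D ht ih =>
    simp only [Finset.mem_insert, not_or] at hj
    obtain ⟨M, σ, hM, hMm, hσ⟩ := ih hj.2
    have hi : IndepOf t fun x : Basis Q => x j := IndepOf.coord hj.1
    refine ⟨_, _, (hM.mul (CostLE.cnot hj.1)).mono (by rw [Finset.card_insert_of_notMem ht]),
      hMm.mul ((MonomialAway.of_ctrl (hi.comp _) hi FlipsIff.xpow).weaken fun _ h => h.elim),
      fun x q => ?_⟩
    rw [Equiv.Perm.mul_apply, hσ, flip_apply, update_of_ne hj.1]
    by_cases hq : q = t
    · subst hq; simp [ht]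
    · simp [hq]

/-- Choose `j` outside `L` with `x j` on. CNOTs from `j` make `x` agree with `y` except at `j`, and
do nothing to labels inside, where bit `j` is off. Then `j` is flipped where the bits in `L` are
those of `y`; among the labels inside this affects only `y`. -/
theorem exists_pivot_step {c a : ℕ} {L : List Q} {T : ℕ}
    (hG : ∀ (t : Q) (ht : t ∉ L), ∃ M : Op Q, ImplLE c a M T ∧
      MonomialAway M (flip t _ (indepOf_all ht)) fun _ => False)
    {x y : Basis Q} (hx : ¬ Inside L x) (hy : Inside L y) :
    ∃ (M : Op Q) (σ : Equiv.Perm (Basis Q)), ImplLE c a M (Fintype.card Q - 1 + T) ∧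
      MonomialAway M σ (fun _ => False) ∧ σ x = y ∧ ∀ z, Inside L z → z ≠ y → σ z = z := by
  simp only [Inside, not_forall, Bool.not_eq_false] at hx
  obtain ⟨j, hj, hxj⟩ := hx
  obtain ⟨G, hGc, hGm⟩ := hG j hj
  obtain ⟨M, σ, hM, hMm, hσ⟩ := exists_fan_out j
    ((Finset.univ.filter fun q => x q ≠ y q).erase j) (by simp)
  have hcard : ((Finset.univ.filter fun q => x q ≠ y q).erase j).card ≤ Fintype.card Q - 1 := by
    rw [← Finset.card_univ, ← Finset.card_erase_of_mem (Finset.mem_univ j)]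
    exact Finset.card_le_card (Finset.erase_subset_erase _ (Finset.subset_univ _))
  -- Bit flips that turn the control pattern "equal to `y` on `L`" into "all on".
  let b : Basis Q := fun q => decide (q ∈ L) && !y q
  have hall : ∀ z : Basis Q, (L.all (xorPerm b z) = true ↔ ∀ q ∈ L, z q = y q) := by
    intro z
    rw [List.all_eq_true]
    refine forall_congr' fun q => forall_congr' fun hq => ?_
    simp only [xorPerm_apply, b, hq]
    cases z q <;> cases y q <;> simp
  have hb : b j = false := by simp [b, hj]
  have hpi : ∀ z, xorPerm b (flip j _ (indepOf_all hj) (xorPerm b z)) =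
      update z j (xor (z j) (decide (∀ q ∈ L, z q = y q))) := by
    intro z
    have : L.all (xorPerm b z) = decide (∀ q ∈ L, z q = y q) := by
      rw [Bool.eq_iff_iff, hall]; simp
    funext q
    rw [xorPerm_apply, flip_apply]
    by_cases hq : q = j
    · subst hq
      simp only [update_self]
      rw [this, hb, xorPerm_apply, hb]; simp
    · simp only [update_of_ne hq]
      rw [xorPerm_apply]; simp
  have hX := ImplLE.of_costLE (c := c) (a := a) (CostLE.xorPerm b)
  refine ⟨_, _, ((hX.mul hGc).mul (hX.mul (ImplLE.of_costLE hM))).mono (by omega),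
    ((MonomialAway.xorPerm b).mul hGm).mul ((MonomialAway.xorPerm b).mul hMm), ?_, ?_⟩
  · simp only [Equiv.Perm.mul_apply]
    rw [hpi]
    have h1 : ∀ q, q ≠ j → σ x q = y q := by
      intro q hq
      rw [hσ, hxj]
      by_cases h : x q = y q
      · simp [h]
      · simp only [Finset.mem_erase, hq, h, Finset.mem_filter, Finset.mem_univ, ne_eq,
          not_false_eq_true, and_self, decide_true, Bool.and_self, Bool.xor_true]
        revert h
        cases x q <;> cases y q <;> simp
    have h2 : ∀ q ∈ L, σ x q = y q := fun q hq => h1 q fun h => hj (h ▸ hq)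
    funext q
    by_cases hq : q = j
    · subst hq
      rw [update_self, hy q hj, hσ, hxj]
      simpa using h2
    · rw [update_of_ne hq, h1 q hq]
  · intro z hz hzy
    have hzj : z j = false := hz j hj
    have h1 : σ z = z := by
      funext q; rw [hσ, hzj]; simp
    simp only [Equiv.Perm.mul_apply]
    rw [hpi, h1]
    have h2 : ¬ ∀ q ∈ L, z q = y q := by
      intro h
      refine hzy (funext fun q => ?_)
      by_cases hq : q ∈ L
      · exact h q hq
      · rw [hz q hq, hy q hq]
    simp [h2]

open Classical in
theorem card_inside {L : List Q} (hL : L.Nodup) :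
    2 ^ L.length ≤ (Finset.univ.filter fun x : Basis Q => Inside L x).card := by
  have h1 : Fintype.card ({q // q ∈ L} → Bool) = 2 ^ L.length := by
    rw [Fintype.card_fun, Fintype.card_bool]
    congr 1
    rw [Fintype.card_of_subtype L.toFinset (by simp), List.toFinset_card_of_nodup hL]
  rw [← h1, ← Finset.card_univ]
  refine Finset.card_le_card_of_injOn (fun f q => if h : q ∈ L then f ⟨q, h⟩ else false) ?_ ?_
  · intro f _
    refine Finset.mem_coe.2 (Finset.mem_filter.2 ⟨Finset.mem_univ _, fun q hq => ?_⟩)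
    simp [hq]
  · intro f _ g _ h
    funext q
    have := congrFun h q.1
    simpa [q.2] using this

open Classical in
-- Induction on the number of support labels still outside. As long as one is outside, the
-- inequality `S.card ≤ 2 ^ L.length` leaves a free label inside to receive it.
theorem exists_pivot {c a : ℕ} {L : List Q} (hL : L.Nodup) {T : ℕ}
    (hG : ∀ (t : Q) (ht : t ∉ L), ∃ M : Op Q, ImplLE c a M T ∧
      MonomialAway M (flip t _ (indepOf_all ht)) fun _ => False) (k : ℕ) :
    ∀ S : Finset (Basis Q), S.card ≤ 2 ^ L.length → (S.filter fun x => ¬ Inside L x).card ≤ k →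
    ∃ (M : Op Q) (σ : Equiv.Perm (Basis Q)), ImplLE c a M (k * (Fintype.card Q - 1 + T)) ∧
      MonomialAway M σ (fun _ => False) ∧ ∀ x ∈ S, Inside L (σ x) := by
  induction k with
  | zero =>
    intro S _ hS
    refine ⟨1, 1, ImplLE.of_costLE (CostLE.one _), MonomialAway.one _, fun x hx => ?_⟩
    by_contra h
    rw [Nat.le_zero, Finset.card_eq_zero] at hS
    exact Finset.notMem_empty x (hS ▸ Finset.mem_filter.2 ⟨hx, h⟩)
  | succ k ih =>
    intro S hcard hS
    by_cases hin : ∀ x ∈ S, Inside L x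
    · exact ⟨1, 1, ImplLE.of_costLE (CostLE.one _), MonomialAway.one _, hin⟩
    push Not at hin
    obtain ⟨x, hxS, hx⟩ := hin
    have hfree : ∃ y, Inside L y ∧ y ∉ S := by
      by_contra! h
      have h1 : (Finset.univ.filter fun x : Basis Q => Inside L x) ⊆ S.erase x := by
        intro y hy
        rw [Finset.mem_filter] at hy
        refine Finset.mem_erase.2 ⟨?_, h y hy.2⟩
        rintro rfl
        exact hx hy.2
      have h2 := Finset.card_le_card h1
      rw [Finset.card_erase_of_mem hxS] at h2
      have h3 := card_inside hL
      have h4 : 0 < 2 ^ L.length := by positivity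
      omega
    obtain ⟨y, hy, hyS⟩ := hfree
    obtain ⟨M, σ, hM, hMm, hσx, hσ⟩ := exists_pivot_step hG hx hy
    -- The labels inside are not expelled, since the only one at risk, `y`, is not in `S`. The other
    -- labels outside may move arbitrarily; their number cannot grow.
    have hsub : ((S.image σ).filter fun x => ¬ Inside L x) ⊆
        ((S.filter fun x => ¬ Inside L x).erase x).image σ := by
      intro z hz
      rw [Finset.mem_filter, Finset.mem_image] at hz
      obtain ⟨⟨w, hw, rfl⟩, hz⟩ := hz
      refine Finset.mem_image_of_mem _ (Finset.mem_erase.2 ⟨?_, Finset.mem_filter.2 ⟨hw, ?_⟩⟩)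
      · rintro rfl
        exact hz (hσx ▸ hy)
      · intro h
        exact hz (by rw [hσ w h fun h' => hyS (h' ▸ hw)]; exact h)
    obtain ⟨M', σ', hM', hMm', hσ'⟩ := ih (S.image σ)
      (Finset.card_image_le.trans hcard) (by
        refine (Finset.card_le_card hsub).trans (Finset.card_image_le.trans ?_)
        rw [Finset.card_erase_of_mem (Finset.mem_filter.2 ⟨hxS, hx⟩)]
        omega)
    refine ⟨_, _, (hM'.mul hM).mono (by rw [Nat.succ_mul]), hMm'.mul hMm, fun z hz => ?_⟩
    exact hσ' _ (Finset.mem_image_of_mem _ hz)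

/-! ### Householder reflections up to diagonal and permutation gates -/

theorem monomial_mulVec (φ : Basis R → ℂ) (π : Equiv.Perm (Basis R)) (ψ : Vec R) (x : Basis R) :
    (monomial φ π *ᵥ ψ) x = φ (π⁻¹ x) * ψ (π⁻¹ x) := by
  rw [Matrix.mulVec, dotProduct, Finset.sum_eq_single (π⁻¹ x)]
  · simp [monomial]
  · intro y _ hy
    have : x ≠ π y := fun h => hy (by rw [h]; simp)
    simp [monomial, this]
  · simp

theorem monomial_eq (φ : Basis R → ℂ) (π : Equiv.Perm (Basis R)) :
    monomial φ π = Matrix.diagonal (fun x => φ (π⁻¹ x)) * (π⁻¹).permMatrix ℂ := by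
  refine op_ext fun ψ x => ?_
  rw [monomial_mulVec, ← Matrix.mulVec_mulVec, Matrix.mulVec_diagonal, Matrix.permMatrix_mulVec]
  rfl

theorem exists_reflection_of_pivoting {c a : ℕ} {v : Vec Q} {D P S : Op Q} {kU kS kH : ℕ}
    (hD : IsDiagonalGate D) (hP : IsPermutationGate P) (hU : (D * P)ᴴ * (D * P) = 1)
    (hS : Sᴴ * S = 1) (hSv : S *ᵥ ketZero = (D * P) *ᵥ v)
    (hUc : ImplLE c a (D * P) kU) (hSc : ImplLE c a S kS)
    (hHc : ImplLE c a (householder (ketZero : Vec Q)) kH) :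
    ∃ V ∈ upToDiagonalPermutation (householder v), ImplLE c a V (2 * kS + kU + kH) := by
  refine ⟨_, ⟨D, P, hD, hP, rfl⟩, ?_⟩
  rw [mul_householder hU, ← hSv, ← householder_conj hS]
  exact (((hSc.mul hHc).mul (hSc.conjTranspose hS)).mul hUc).mono (by omega)

theorem IsState.exists_ne_zero {v : Vec R} (hv : IsState v) : ∃ x, v x ≠ 0 := by
  by_contra! h
  simp [IsState, h] at hv

open Classical in
-- The diagonal gate on `L` pays `2 ^ L.length - 2` once to make the pivoted state non-negative.
-- Both uses of the preparation are then real, so their total is three such terms rather than the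
-- four that two complex preparations would need.
theorem exists_reflection {c a : ℕ} {L : List Q} (hL : L.Nodup) {T H : ℕ}
    (hG : ∀ (t : Q) (ht : t ∉ L), ∃ M : Op Q, ImplLE c a M T ∧
      MonomialAway M (flip t _ (indepOf_all ht)) fun _ => False)
    (hH : ImplLE c a (householder (ketZero : Vec Q)) H) {v : Vec Q} (hv : IsState v)
    (hn : nnz v ≤ 2 ^ L.length) :
    ∃ V ∈ upToDiagonalPermutation (householder v), ImplLE c a V
      ((nnz v - 1) * (Fintype.card Q - 1 + T) + 3 * (2 ^ L.length - 2) + H) := by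
  obtain ⟨x₀, hx₀⟩ := hv.exists_ne_zero
  -- Free bit flips bring one support label inside, which saves one pivoting step.
  let b : Basis Q := fun q => !decide (q ∈ L) && x₀ q
  let S₀ : Finset (Basis Q) := Finset.univ.filter fun x => v x ≠ 0
  have hS₀ : S₀.card = nnz v := by
    rw [nnz, ← Set.ncard_coe_finset]
    congr 1
    ext x; simp [S₀]
  have hmem : x₀ ∈ S₀ := by simp [S₀, hx₀]
  have hx₀in : Inside L (xorPerm b x₀) := by
    intro q hq
    simp [xorPerm_apply, b, hq]
  obtain ⟨M, σ, hM, hMm, hσ⟩ := exists_pivot hL hG (nnz v - 1) (S₀.image (xorPerm b))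
    (by rw [Finset.card_image_of_injective _ (xorPerm b).injective, hS₀]; exact hn) (by
      have h1 : ((S₀.image (xorPerm b)).filter fun x => ¬ Inside L x) ⊆
          (S₀.image (xorPerm b)).erase (xorPerm b x₀) := by
        intro z hz
        rw [Finset.mem_filter] at hz
        refine Finset.mem_erase.2 ⟨?_, hz.1⟩
        rintro rfl
        exact hz.2 hx₀in
      refine (Finset.card_le_card h1).trans ?_
      rw [Finset.card_erase_of_mem (Finset.mem_image_of_mem _ hmem),
        Finset.card_image_of_injective _ (xorPerm b).injective, hS₀])
  have hM₁c := hM.mul (ImplLE.of_costLE (CostLE.xorPerm b))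
  obtain ⟨φ, hφ, hM₁, -⟩ := hMm.mul (MonomialAway.xorPerm b)
  set π := σ * xorPerm b with hπ
  rw [hM₁] at hM₁c
  set w : Vec Q := monomial φ π *ᵥ v with hw
  have hwin : ∀ x, w x ≠ 0 → Inside L x := by
    intro x hx
    rw [hw, monomial_mulVec] at hx
    have h1 : π⁻¹ x ∈ S₀ := by
      simp only [S₀, Finset.mem_filter, Finset.mem_univ, true_and]
      exact right_ne_zero_of_mul hx
    have h2 := hσ _ (Finset.mem_image_of_mem (xorPerm b) h1)
    have h3 : σ (xorPerm b (π⁻¹ x)) = π (π⁻¹ x) := rfl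
    rw [h3] at h2
    simpa using h2
  -- Clearing the bits outside `L` makes phases and moduli of `w` depend on `L` only, without
  -- changing them on its support.
  let res : Basis Q → Basis Q := fun x q => if q ∈ L then x q else false
  have hres : ∀ x, Inside L x → res x = x := by
    intro x hx
    funext q
    by_cases hq : q ∈ L
    · simp [res, hq]
    · simp [res, hq, hx q hq]
  have hdep : DependsOnList res L := by
    intro x y hxy
    funext q
    by_cases hq : q ∈ L
    · simp [res, hq, hxy q hq]
    · simp [res, hq]
  have hθ : DependsOnList (fun x => -Complex.arg (w (res x))) L := by
    intro x y hxy
    simp only [hdep x y hxy]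
  have hr : DependsOnList (fun x => ‖w (res x)‖) L := by
    intro x y hxy
    simp only [hdep x y hxy]
  have hDc := CostLE.diagonal_exp L _ hL hθ
  set d : Basis Q → ℂ := fun x =>
    Complex.exp ((-Complex.arg (w (res x)) : ℝ) * Complex.I) with hd
  have hdn : ∀ x, ‖d x‖ = 1 := fun x => Complex.norm_exp_ofReal_mul_I _
  have hMU : (monomial φ π)ᴴ * monomial φ π = 1 := by
    have h := (show MonomialAway (monomial φ π) π (fun _ => False) from
      ⟨φ, hφ, rfl, fun _ h => h.elim⟩).conj_diagonal fun _ => 1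
    simpa using h
  have hU : (Matrix.diagonal d * monomial φ π)ᴴ * (Matrix.diagonal d * monomial φ π) = 1 := by
    rw [Matrix.conjTranspose_mul, Matrix.mul_assoc, ← Matrix.mul_assoc _ (Matrix.diagonal d),
      hDc.conjTranspose_mul_self, Matrix.one_mul, hMU]
  have hw' : (Matrix.diagonal d * monomial φ π) *ᵥ v =
      fun x => if ∀ q, q ∉ L → x q = false then ((‖w (res x)‖ : ℝ) : ℂ) else 0 := by
    rw [← Matrix.mulVec_mulVec, ← hw]
    funext x
    rw [Matrix.mulVec_diagonal]
    split_ifs with h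
    · rw [hd]
      simp only [hres x h]
      conv_lhs => rw [← Complex.norm_mul_exp_arg_mul_I (w x)]
      rw [mul_left_comm, ← Complex.exp_add]
      simp
    · have : w x = 0 := by
        by_contra h'
        exact h (hwin x h')
      simp [this]
  obtain ⟨S, hSc, hS⟩ := CostLE.exists_prepare_state hL hr hw' ((isState_mulVec hU).2 hv)
  have heq : Matrix.diagonal d * monomial φ π =
      Matrix.diagonal (fun x => d x * φ (π⁻¹ x)) * (π⁻¹).permMatrix ℂ := by
    rw [monomial_eq, ← Matrix.mul_assoc, Matrix.diagonal_mul_diagonal]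
  have hUc := (ImplLE.of_costLE (c := c) (a := a) hDc).mul hM₁c
  rw [heq] at hS hU hUc
  obtain ⟨V, hV, hVc⟩ := exists_reflection_of_pivoting
    ⟨_, fun x => by rw [norm_mul, hdn, hφ, one_mul], rfl⟩ ⟨π⁻¹, rfl⟩ hU
    hSc.conjTranspose_mul_self hS hUc (ImplLE.of_costLE hSc) hH
  exact ⟨V, hV, hVc.mono (by omega)⟩

/-! ### Minimal CNOT counts -/

theorem minCNOT_le {c a N : ℕ} {S : Set (Op Q)} (h : Achievable c a S N) : minCNOT c a S ≤ N :=
  iInf₂_le (f := fun (N : ℕ) (_ : Achievable c a S N) => (N : ℕ∞)) N h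

theorem exists_achievable {c a : ℕ} {S : Set (Op Q)} (h : minCNOT c a S ≠ ⊤) :
    ∃ N : ℕ, Achievable c a S N ∧ minCNOT c a S = N := by
  classical
  have hex : ∃ N, Achievable c a S N := by
    by_contra! h'
    exact h (by simp [minCNOT, h'])
  refine ⟨Nat.find hex, Nat.find_spec hex, le_antisymm (minCNOT_le (Nat.find_spec hex)) ?_⟩
  exact le_iInf₂ fun N hN => Nat.cast_le.2 (Nat.find_min' hex hN)

theorem Achievable.of_implLE {c a k : ℕ} {S : Set (Op Q)} {U : Op Q} (hU : U ∈ S)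
    (h : ImplLE c a U k) : ∃ N, Achievable c a S N ∧ N ≤ k :=
  let ⟨C, hC, hk⟩ := h
  ⟨_, ⟨C, U, hU, hC, rfl⟩, hk⟩

theorem Achievable.exists_implLE {c a N : ℕ} {S : Set (Op Q)} (h : Achievable c a S N) :
    ∃ U ∈ S, ImplLE c a U N :=
  let ⟨C, U, hU, hC, hN⟩ := h
  ⟨U, hU, C, hC, hN.le⟩

/-! ### Reflections from pivoting and state preparation -/

theorem liftOp_mulVec_ketZero {e : Q → R} (he : Injective e) (U : Op Q) (x : Basis R)
    [Decidable (∀ r, r ∉ Set.range e → x r = false)] :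
    (liftOp e U *ᵥ ketZero) x =
      if ∀ r, r ∉ Set.range e → x r = false then (U *ᵥ ketZero) (x ∘ e) else 0 := by
  rw [liftOp_mulVec he]
  have key : ∀ y : Basis Q, extend e y x = (fun _ => false) ↔
      (∀ r, r ∉ Set.range e → x r = false) ∧ y = fun _ => false := by
    intro y
    constructor
    · intro h
      refine ⟨fun r hr => ?_, ?_⟩
      · rw [← extend_apply' y x r hr, h]
      · have := extend_comp he y x
        rw [h] at this
        rw [← this]; rfl
    · rintro ⟨h1, rfl⟩
      funext r
      by_cases h : ∃ q, e q = r
      · obtain ⟨q, rfl⟩ := h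
        rw [he.extend_apply]
      · rw [extend_apply' _ _ _ h, h1 r h]
  have hz : ∀ y : Basis Q, (ketZero : Vec R) (extend e y x) =
      if ∀ r, r ∉ Set.range e → x r = false then ketZero y else 0 := by
    intro y
    rw [ketZero, ket, Pi.single_apply, ketZero, ket, Pi.single_apply, ← ite_and]
    exact if_congr (key y) rfl rfl
  simp only [hz]
  split_ifs with h
  · rfl
  · simp

theorem IsDiagonalGate.conjTranspose_mul_self {D : Op Q} (h : IsDiagonalGate D) : Dᴴ * D = 1 := by
  obtain ⟨d, hd, rfl⟩ := h
  rw [Matrix.diagonal_conjTranspose, Matrix.diagonal_mul_diagonal, ← Matrix.diagonal_one]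
  congr 1
  funext x
  simp only [Pi.star_apply, Complex.star_def, Complex.conj_mul', hd]
  simp

theorem IsPermutationGate.conjTranspose_mul_self {P : Op Q} (h : IsPermutationGate P) :
    Pᴴ * P = 1 := by
  obtain ⟨σ, rfl⟩ := h
  rw [Matrix.conjTranspose_permMatrix, ← Matrix.permMatrix_mul]
  simp

theorem conjTranspose_mul_self_mul {U V : Op Q} (hU : Uᴴ * U = 1) (hV : Vᴴ * V = 1) :
    (U * V)ᴴ * (U * V) = 1 := by
  rw [Matrix.conjTranspose_mul, Matrix.mul_assoc, ← Matrix.mul_assoc Uᴴ, hU, Matrix.one_mul, hV]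

theorem liftOp_conjTranspose_mul_self {e : Q → R} (he : Injective e) {U : Op Q}
    (hU : Uᴴ * U = 1) : (liftOp e U)ᴴ * liftOp e U = 1 := by
  have h : (liftOp e U)ᴴ = liftOp e Uᴴ := by
    ext x y
    simp only [liftOp, Matrix.conjTranspose_apply, Matrix.of_apply]
    by_cases h : ∀ r, r ∉ Set.range e → x r = y r
    · rw [if_pos h, if_pos fun r hr => (h r hr).symm]
    · rw [if_neg h, if_neg fun h' => h fun r hr => (h' r hr).symm, star_zero]
  rw [h, ← liftOp_mul he, hU]
  simpa using liftOp_smul_one he (1 : ℂ)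

/-- The position of the `j`-th of the last `s` qubits. -/
def lastQubit {n s : ℕ} (h : s ≤ n) (j : Fin s) : Fin n := ⟨n - s + j, by omega⟩

theorem lastQubit_injective {n s : ℕ} (h : s ≤ n) : Injective (lastQubit h) := by
  intro i j hij
  simp only [lastQubit, Fin.mk.injEq] at hij
  exact Fin.ext (by omega)

theorem mem_range_lastQubit {n s : ℕ} (h : s ≤ n) (q : Fin n) :
    q ∈ Set.range (lastQubit h) ↔ n - s ≤ q := by
  constructor
  · rintro ⟨j, rfl⟩
    simp [lastQubit]
  · intro hq
    exact ⟨⟨q - (n - s), by omega⟩, Fin.ext (by simp only [lastQubit]; omega)⟩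

theorem exists_preparation_of_isPivoted {c a n s N : ℕ} {w : Vec (Fin n)}
    (hN : ∀ u : Vec (Fin s), IsState u → ∃ U ∈ statePreparations u, ImplLE c a U N)
    {D : Op (Fin n)} (hD : IsDiagonalGate D) (hw : IsPivoted s w) :
    ∃ S : Op (Fin n), Sᴴ * S = 1 ∧ S *ᵥ ketZero = D *ᵥ w ∧ ImplLE c a S N := by
  obtain ⟨h, i, u, hu, hwx⟩ := hw
  obtain ⟨d, hd, rfl⟩ := hD
  -- On the subcube selected by `i`, the diagonal gate multiplies `u` by the phases `d ∘ comb`. The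
  -- product is still a state, and it is the one prepared below.
  let comb : Basis (Fin s) → Basis (Fin n) := fun y q =>
    if hq : (q : ℕ) < n - s then i ⟨q, hq⟩ else y ⟨q - (n - s), by omega⟩
  have hu' : IsState fun y => d (comb y) * u y := by
    simpa only [IsState, norm_mul, hd, one_mul] using hu
  obtain ⟨U, ⟨hU, hUu⟩, hUc⟩ := hN _ hu'
  have he := lastQubit_injective h
  have hU1 : Uᴴ * U = 1 := Matrix.mem_unitaryGroup_iff'.1 hU
  let b := comb fun _ => false
  have hX := CostLE.xorPerm b
  refine ⟨monomial (fun _ => 1) (xorPerm b) * liftOp (lastQubit h) U,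
    conjTranspose_mul_self_mul hX.conjTranspose_mul_self (liftOp_conjTranspose_mul_self he hU1),
    ?_, ((ImplLE.of_costLE hX).mul (hUc.lift he)).mono (by omega)⟩
  classical
  rw [← Matrix.mulVec_mulVec]
  funext x
  rw [monomial_mulVec, liftOp_mulVec_ketZero he, hUu, Matrix.mulVec_diagonal, hwx, one_mul]
  have hinv : ∀ q, (xorPerm b)⁻¹ x q = xor (x q) (b q) := fun q => rfl
  have h1 : (∀ r, r ∉ Set.range (lastQubit h) → (xorPerm b)⁻¹ x r = false) ↔
      (fun j : Fin (n - s) => x ⟨j, by omega⟩) = i := by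
    simp only [mem_range_lastQubit, hinv, not_le, funext_iff]
    constructor
    · intro hx j
      have := hx ⟨j, by omega⟩ j.2
      simpa [b, comb] using this
    · intro hx r hr
      have := hx ⟨r, hr⟩
      simp only at this
      simp [b, comb, hr, this]
  have h2 : (xorPerm b)⁻¹ x ∘ lastQubit h = fun j : Fin s => x ⟨n - s + j, by omega⟩ := by
    funext j
    rw [comp_apply, hinv]
    have : b (lastQubit h j) = false := by simp [b, comb, lastQubit]
    rw [this]
    simp [lastQubit]
  rw [h2]
  by_cases hx : (fun j : Fin (n - s) => x ⟨j, by omega⟩) = i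
  · rw [if_pos (h1.2 hx)]
    have hcomb : comb (fun j => x ⟨n - s + j, by omega⟩) = x := by
      funext q
      by_cases hq : (q : ℕ) < n - s
      · simp only [comb, dif_pos hq]
        exact (congrFun hx ⟨q, hq⟩).symm
      · simp only [comb, dif_neg hq]
        congr 1
        exact Fin.ext (by simp only; omega)
    simp only [hcomb, hx, ket, Pi.single_eq_same, one_mul]
  · rw [if_neg (fun h' => hx (h1.1 h'))]
    simp [ket, hx]

theorem countHouseholder_le (c a n s : ℕ) :
    countHouseholder c a n s ≤
      2 * countSP c a s + countPivDiag c a n s + countH0 c a n := by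
  by_cases hSP : countSP c a s = ⊤
  · simp [hSP]
  by_cases hPiv : countPivDiag c a n s = ⊤
  · simp [hPiv]
  by_cases hH0 : countH0 c a n = ⊤
  · simp [hH0]
  refine iSup₂_le fun v hv => ?_
  have h1 : minCNOT c a (pivotingsUpToDiagonal s v) ≤ countPivDiag c a n s :=
    le_iSup₂ (f := fun (v : Vec (Fin n)) (_ : IsState v ∧ nnz v ≤ 2 ^ s) =>
      minCNOT c a (pivotingsUpToDiagonal s v)) v hv
  obtain ⟨kU, hkU, hkU'⟩ := exists_achievable (ne_top_of_le_ne_top hPiv h1)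
  obtain ⟨kH, hkH, hkH'⟩ := exists_achievable hH0
  obtain ⟨kS, hkS⟩ := ENat.ne_top_iff_exists.1 hSP
  obtain ⟨U, ⟨D, P, hD, hP, hpiv, rfl⟩, hU⟩ := hkU.exists_implLE
  obtain ⟨H, rfl, hH⟩ := hkH.exists_implLE
  have hSall : ∀ u : Vec (Fin s), IsState u → ∃ U ∈ statePreparations u, ImplLE c a U kS := by
    intro u hu
    have h2 : minCNOT c a (statePreparations u) ≤ countSP c a s :=
      le_iSup₂ (f := fun (u : Vec (Fin s)) (_ : IsState u) =>
        minCNOT c a (statePreparations u)) u hu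
    obtain ⟨N, hN, hN'⟩ := exists_achievable (ne_top_of_le_ne_top hSP h2)
    obtain ⟨U, hU, hUN⟩ := hN.exists_implLE
    refine ⟨U, hU, hUN.mono ?_⟩
    rw [hN', ← hkS] at h2
    exact_mod_cast h2
  obtain ⟨S, hS, hSv, hSc⟩ := exists_preparation_of_isPivoted hSall hD hpiv
  rw [Matrix.mulVec_mulVec] at hSv
  obtain ⟨V, hV, hVc⟩ := exists_reflection_of_pivoting hD hP
    (conjTranspose_mul_self_mul hD.conjTranspose_mul_self hP.conjTranspose_mul_self) hS hSv hU hSc hH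
  obtain ⟨N, hN, hNle⟩ := Achievable.of_implLE hV hVc
  rw [← hkS, countH0, hkH']
  rw [hkU'] at h1
  calc minCNOT c a (upToDiagonalPermutation (householder v)) ≤ (N : ℕ∞) := minCNOT_le hN
    _ ≤ ((2 * kS + kU + kH : ℕ) : ℕ∞) := Nat.cast_le.2 hNle
    _ = 2 * (kS : ℕ∞) + kU + kH := by push_cast; rfl
    _ ≤ _ := by gcongr

/-! ### The explicit bounds -/

/-- The reflection is itself a diagonal gate with entries ±1, so it can be cancelled by `Δ = H_v`,
and the empty circuit remains. -/
theorem exists_reflection_of_nnz_eq_one {c a : ℕ} {v : Vec Q} (hv : IsState v) (h1 : nnz v = 1) :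
    Achievable c a (upToDiagonalPermutation (householder v)) 0 := by
  obtain ⟨x₀, hx₀⟩ := Set.ncard_eq_one.1 h1
  have hne : ∀ x, x ≠ x₀ → v x = 0 := by
    intro x hx
    by_contra h
    have : x ∈ support v := h
    rw [hx₀] at this
    exact hx this
  have hsq : v x₀ * star (v x₀) = 1 := by
    rw [isState_iff, dotProduct, Finset.sum_eq_single x₀] at hv
    · rw [mul_comm]; exact hv
    · intro x _ hx; simp [hne x hx]
    · simp
  have hdiag : householder v = Matrix.diagonal fun x => if x = x₀ then -1 else 1 := by
    ext x y
    simp only [householder, Matrix.sub_apply, Matrix.smul_apply, Matrix.vecMulVec_apply,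
      Matrix.one_apply, Matrix.diagonal_apply, Pi.star_apply, smul_eq_mul]
    by_cases hxy : x = y
    · subst hxy
      by_cases hx : x = x₀
      · subst hx
        rw [hsq]; norm_num
      · simp [hne x hx, hx]
    · by_cases hx : x = x₀
      · have hy : y ≠ x₀ := fun h => hxy (hx.trans h.symm)
        simp [hxy, hne y hy]
      · simp [hxy, hne x hx]
  refine ⟨[], 1, ⟨householder v, 1, ⟨_, fun x => ?_, hdiag⟩, ⟨1, by simp⟩, ?_⟩,
    fun ψ φ => by simp [circuitOp], by simp [cnotCount]⟩
  · split_ifs <;> simp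
  · rw [Matrix.mul_one, hdiag, Matrix.diagonal_mul_diagonal, ← Matrix.diagonal_one]
    congr 1
    funext x
    split_ifs <;> simp

theorem nnz_le (v : Vec Q) : nnz v ≤ 2 ^ Fintype.card Q := by
  have h := Set.ncard_le_card (support v)
  rwa [Nat.card_eq_fintype_card, Fintype.card_fun, Fintype.card_bool] at h

theorem IsState.one_le_nnz {v : Vec Q} (hv : IsState v) : 1 ≤ nnz v := by
  obtain ⟨x, hx⟩ := hv.exists_ne_zero
  exact (Set.ncard_pos (Set.toFinite _)).2 ⟨x, hx⟩

/-- The explicit bound, from the bounds `T` for controlled flips and `H` for the reflection about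
the all-zero state. -/
theorem exists_achievable_le {c a n : ℕ} {v : Vec (Fin n)} (hv : IsState v) (h2 : 2 ≤ nnz v)
    {T H : ℕ}
    (hG : ∀ (L : List (Fin n)), L.Nodup → L.length = Nat.clog 2 (nnz v) →
      ∀ (t : Fin n) (ht : t ∉ L), ∃ M : Op (Fin n), ImplLE c a M T ∧
      MonomialAway M (flip t _ (indepOf_all ht)) fun _ => False)
    (hH : ImplLE c a (householder (ketZero : Vec (Fin n))) H) :
    ∃ N : ℕ, Achievable c a (upToDiagonalPermutation (householder v)) N ∧
      (N : ℤ) + 11 ≤ (nnz v - 1) * (n + T) + 5 * nnz v + H := by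
  have hs : Nat.clog 2 (nnz v) ≤ n := by
    refine Nat.clog_le_of_le_pow ?_
    simpa using nnz_le v
  set s := Nat.clog 2 (nnz v) with hsdef
  have hs1 : 1 ≤ s := Nat.clog_pos (by norm_num) h2
  have hle : nnz v ≤ 2 ^ s := Nat.le_pow_clog (by norm_num) _
  have hlt : 2 ^ (s - 1) < nnz v := by
    have := Nat.pow_pred_clog_lt_self (b := 2) (by norm_num) (show 1 < nnz v by omega)
    simpa [hsdef] using this
  -- Any `s` qubits will do; the first ones are taken.
  have hlen : ((List.finRange n).take s).length = s := by simp [hs]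
  have hnd : ((List.finRange n).take s).Nodup := (List.nodup_finRange n).sublist (List.take_sublist _ _)
  obtain ⟨V, hV, hVc⟩ := exists_reflection hnd (hG _ hnd hlen) hH hv (by rwa [hlen])
  obtain ⟨N, hN, hNle⟩ := Achievable.of_implLE hV hVc
  refine ⟨N, hN, ?_⟩
  have hpow : 2 ^ s = 2 * 2 ^ (s - 1) := by
    rw [← pow_succ', Nat.sub_add_cancel hs1]
  have hpow1 : 1 ≤ 2 ^ (s - 1) := Nat.one_le_two_pow
  rw [hlen, Fintype.card_fin] at hNle
  -- Here `2 ^ (s - 1) ≤ nnz v - 1` gives `3 * (2 ^ s - 2) ≤ 6 * nnz v - 12`. Replacing `n - 1 + T`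
  -- by `n + T` frees another `nnz v - 1`, whence the 5 and the 11 in the claim.
  have hNle' : N ≤ (nnz v - 1) * (n - 1 + T) + (6 * nnz v - 12) + H := by omega
  zify [show 1 ≤ nnz v by omega, show 1 ≤ n by omega, show 12 ≤ 6 * nnz v by omega] at hNle'
  linarith

end QCircuit

end

theorem mainTheorem8 (n : ℕ) (hn : 1 ≤ n) (v : QCircuit.Vec (Fin n)) (hv : QCircuit.IsState v)
    (s : ℕ) (hs : s = Nat.clog 2 (QCircuit.nnz v)) :
    (∀ c a : ℕ,
      QCircuit.minCNOT c a (QCircuit.upToDiagonalPermutation (QCircuit.householder v))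
          ≤ QCircuit.countHouseholder c a n s ∧
      QCircuit.countHouseholder c a n s
          ≤ 2 * QCircuit.countSP c a s + QCircuit.countPivDiag c a n s
            + QCircuit.countH0 c a n) ∧
    (∃ N : ℕ,
      QCircuit.Achievable 0 1 (QCircuit.upToDiagonalPermutation (QCircuit.householder v)) N ∧
      (N : ℤ) ≤ ((n : ℤ) + 16 * s - 5) * QCircuit.nnz v + 16 * n) ∧
    (∃ N : ℕ,
      QCircuit.Achievable ⌈((n : ℚ) - 3) / 2⌉₊ 0
        (QCircuit.upToDiagonalPermutation (QCircuit.householder v)) N ∧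
      (N : ℤ) ≤ ((n : ℤ) + 6 * s - 3) * QCircuit.nnz v + 6 * n) := by
  open QCircuit in
  refine ⟨fun c a => ⟨?_, countHouseholder_le c a n s⟩, ?_⟩
  · exact le_iSup₂ (f := fun (w : Vec (Fin n)) (_ : IsState w ∧ nnz w ≤ 2 ^ s) =>
      minCNOT c a (upToDiagonalPermutation (householder w))) v
      ⟨hv, hs ▸ Nat.le_pow_clog (by norm_num) _⟩
  have hn' : (1 : ℤ) ≤ n := by exact_mod_cast hn
  rcases Nat.eq_or_lt_of_le hv.one_le_nnz with h1 | h2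
  · have hs0 : s = 0 := by rw [hs, ← h1]; simp
    -- With one non-zero entry the bounds are `17 * n - 5` and `7 * n - 3`, non-negative because `1
    -- ≤ n`.
    refine ⟨⟨0, exists_reflection_of_nnz_eq_one hv h1.symm, ?_⟩,
      ⟨0, exists_reflection_of_nnz_eq_one hv h1.symm, ?_⟩⟩ <;>
    · rw [← h1, hs0]; push_cast; linarith
  have hm : (2 : ℤ) ≤ nnz v := by exact_mod_cast h2
  have hs1 : 1 ≤ s := hs ▸ Nat.clog_pos (by norm_num) h2
  have hsn : s ≤ n := by
    rw [hs]
    refine Nat.clog_le_of_le_pow ?_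
    simpa using nnz_le v
  -- The natural-number ceiling is 0 for negative arguments, which supplies the maximum with 0. The
  -- inequality is the capacity required by `exists_compress`.
  have hc : n ≤ 2 * ⌈((n : ℚ) - 3) / 2⌉₊ + 3 := by
    have h := Nat.le_ceil (((n : ℚ) - 3) / 2)
    have : (n : ℚ) ≤ ((2 * ⌈((n : ℚ) - 3) / 2⌉₊ + 3 : ℕ) : ℚ) := by push_cast; linarith
    exact_mod_cast this
  have hH0 := ImplLE.householder_ketZero_dirty (List.nodup_finRange n) List.mem_finRange
  have hH0' := ImplLE.householder_ketZero_clean (List.nodup_finRange n) List.mem_finRange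
    (by simpa using hc)
  rw [List.length_finRange] at hH0 hH0'
  rcases Nat.eq_or_lt_of_le hs1 with hs1 | hs2
  -- A flip with one control is a CNOT, so `T = 1`; the general costs `16 * s - 16` and `6 * s - 9`
  -- would be 0 in natural numbers.
  · have hmle : (nnz v : ℤ) ≤ 2 := by
      have : nnz v ≤ 2 ^ s := hs ▸ Nat.le_pow_clog (by norm_num) _
      rw [← hs1] at this
      exact_mod_cast this
    have hm2 : (nnz v : ℤ) = 2 := le_antisymm hmle hm
    obtain ⟨N, hN, hNle⟩ := exists_achievable_le hv h2 (fun L _ hlen t ht =>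
      exists_flip_of_small 0 1 ht (by rw [hlen, ← hs, ← hs1])) hH0
    obtain ⟨N', hN', hNle'⟩ := exists_achievable_le hv h2 (fun L _ hlen t ht =>
      exists_flip_of_small ⌈((n : ℚ) - 3) / 2⌉₊ 0 ht (by rw [hlen, ← hs, ← hs1])) hH0'
    refine ⟨⟨N, hN, ?_⟩, ⟨N', hN', ?_⟩⟩
    · rw [hm2] at hNle ⊢
      push_cast at hNle
      rw [← hs1]; push_cast
      linarith
    · rw [hm2] at hNle' ⊢
      push_cast at hNle'
      rw [← hs1]; push_cast
      linarith
  · have hs2' : (2 : ℤ) ≤ s := by exact_mod_cast hs2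
    obtain ⟨N, hN, hNle⟩ := exists_achievable_le (T := 16 * s - 16) hv h2 (fun L hL hlen t ht => by
      have hlen' : L.length = s := by rw [hlen, hs]
      rw [← hlen']
      exact exists_flip_dirty 0 1 ht hL (by omega)) hH0
    obtain ⟨N', hN', hNle'⟩ := exists_achievable_le (T := 6 * s - 9) hv h2 (fun L hL hlen t ht => by
      have hlen' : L.length = s := by rw [hlen, hs]
      rw [← hlen']
      exact exists_flip_clean ht hL (by omega) (by omega)) hH0'
    refine ⟨⟨N, hN, ?_⟩, ⟨N', hN', ?_⟩⟩
    · rw [Nat.cast_sub (by omega)] at hNle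
      push_cast at hNle
      linarith
    · rw [Nat.cast_sub (by omega)] at hNle'
      push_cast at hNle'
      linarith
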